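/- Let $q$ be a prime power, let $\mathbb F_q$ be the field with $q$ elements, and let $\mathbb C_\infty$ be the completion of an algebraic closure of the completion of $\mathbb F_q(\theta)$ at infinity, with the valuation $\operatorname{ord}$ normalized by $\operatorname{ord}\theta=-1$ (and $\operatorname{ord}0=+\infty$). Let $\mathbb C_\infty[T,\tau]$ be the ring generated over $\mathbb C_\infty$ by $T,\tau$ with $Ta=aT$, $T\tau=\tau T$, $\tau a=a^q\tau$ for $a\in\mathbb C_\infty$. For $A\in M_{2\times 2}(\mathbb C_\infty)$ let $M(A)$ be the left $\mathbb C_\infty[T,\tau]$-module which is free over $\mathbb C_\infty\{\tau\}$ (the subring generated by $\mathbb C_\infty$ and $\tau$) with basis $e_1,e_2$, put $e=(e_1,e_2)^t$, and let $Te=\theta e+A\tau e+\tau^2e$; it is free of rank $4$ over $\mathbb C_\infty[T]$. Let $\mathbb C_\infty\{T\}$ be the ring of power series $\sum_{i\ge0} a_iT^i$ over $\mathbb C_\infty$ with $a_i\to0$, on which $\tau$ acts by $\sum a_iT^i\mapsto\sum a_i^qT^i$; let $\tau$ act on $M\otimes_{\mathbb C_\infty[T]}\mathbb C_\infty\{T\}$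 by $\tau(m\otimes f)=\tau m\otimes\tau f$, let $H^1(M)$ be the $\mathbb F_q[T]$-module of $\tau$-invariant elements, and let $h^1(M)$ be its rank. $M$ is called uniformizable if $h^1(M)$ equals the rank of $M$ over $\mathbb C_\infty[T]$. For $a_{12},a_{21}\in\mathbb C_\infty$ put $A=\begin{pmatrix}0&a_{12}\\a_{21}&0\end{pmatrix}$. (1) If $\operatorname{ord}a_{12}>-\frac{q^2}{q-1}$ and $\operatorname{ord}a_{21}>-\frac{q^2}{q-1}$, then $M(A)$ is uniformizable, i.e. $h^1(M(A))=4$. (2) There are $a_{12},a_{21}\in\mathbb C_\infty$ with $\operatorname{ord}a_{12}=\frac1{q-1}$ and $\operatorname{ord}a_{21}=-\frac{q^2}{q-1}$ such that $h^1(M(A))=0$; in particular $M(A)$ is not uniformizable. (3) Consequently the bound in (1) is sharp: $-\frac{q^2}{q-1}$ is the least $C\in[-\infty,+\infty]$ such that $M(A)$ is uniformizable whenever $\operatorname{ord}a_{12}>C$ and $\operatorname{ord}a_{21}>C$. -/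

import Mathlib

open scoped Polynomial TensorProduct NNReal

noncomputable section

universe u

namespace AndersonMotive

/-! ### The field `ℂ_∞` -/

section Field

section Completion

attribute [-instance] RatFunc.valuedRatFunc

open scoped RatFunc.CompletionAtInfty

variable (F : Type u) [Field F] [DecidableEq (RatFunc F)]

instance completeSpaceCompletionAtInfty : CompleteSpace (RatFunc.CompletionAtInfty F) :=
  inferInstanceAs (CompleteSpace (UniformSpace.Completion (RatFunc F)))

theorem valuation_X :
    Valued.v (algebraMap (RatFunc F) (RatFunc.CompletionAtInfty F) RatFunc.X) =
      WithZero.exp (1 : ℤ) := by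
  let := RatFunc.inftyValued F
  refine Eq.trans ?_ (RatFunc.inftyValuation.X F)
  exact Valued.extensionValuation_apply_coe (K := RatFunc F) RatFunc.X

end Completion

variable (F : Type u) [Field F]

/-- The completion of `F(θ)` with respect to the valuation at infinity. -/
abbrev KInfty : Type u :=
  letI := Classical.decEq (RatFunc F)
  RatFunc.CompletionAtInfty F

variable [Fintype F]

theorem one_lt_card : (1 : ℝ≥0) < (Fintype.card F : ℝ≥0) := by
  exact_mod_cast Fintype.one_lt_card

/-- The valuation at infinity, read as an absolute value normalized by `|θ| = q`. -/
instance rankOneKInfty :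
    (Valued.v : Valuation (KInfty F) (WithZero (Multiplicative ℤ))).RankOne where
  hom' := (WithZeroMulInt.toNNReal (ne_of_gt (lt_trans zero_lt_one (one_lt_card F)))).comp
    MonoidWithZeroHom.ValueGroup₀.embedding
  strictMono' := (WithZeroMulInt.toNNReal_strictMono (one_lt_card F)).comp
    MonoidWithZeroHom.ValueGroup₀.embedding_strictMono
  exists_val_nontrivial :=
    letI := Classical.decEq (RatFunc F)
    ⟨algebraMap (RatFunc F) (KInfty F) RatFunc.X, by rw [valuation_X]; simp,
      by rw [valuation_X]; simp⟩

instance normedFieldKInfty : NormedField (KInfty F) :=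
  Valued.toNormedField (KInfty F) (WithZero (Multiplicative ℤ))

theorem KInfty.norm_X : ‖algebraMap (RatFunc F) (KInfty F) RatFunc.X‖ = Fintype.card F := by
  let := Classical.decEq (RatFunc F)
  have h : ‖algebraMap (RatFunc F) (KInfty F) RatFunc.X‖ =
    ((WithZeroMulInt.toNNReal (ne_of_gt (lt_trans zero_lt_one (one_lt_card F)))
      (MonoidWithZeroHom.ValueGroup₀.embedding
      ((Valued.v : Valuation (KInfty F) (WithZero (Multiplicative ℤ))).restrict
      (algebraMap (RatFunc F) (KInfty F) RatFunc.X))) : ℝ≥0) : ℝ) := rfl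
  rw [h, Valuation.embedding_restrict, valuation_X, WithZeroMulInt.toNNReal_neg_apply _ (by simp)]
  have h1 : Multiplicative.toAdd (WithZero.unzero
      (x := (WithZero.exp (1 : ℤ) : WithZero (Multiplicative ℤ))) (by simp)) = 1 := rfl
  rw [h1]
  simp

instance nontriviallyNormedFieldKInfty : NontriviallyNormedField (KInfty F) where
  __ := normedFieldKInfty F
  non_trivial := ⟨algebraMap (RatFunc F) (KInfty F) RatFunc.X, by
    rw [KInfty.norm_X]; exact_mod_cast Fintype.one_lt_card⟩

instance isUltrametricDistKInfty : IsUltrametricDist (KInfty F) :=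
  ⟨fun x y z ↦ by
    refine (Valuation.norm_add_le Valued.v (x - y) (y - z)).trans_eq' ?_
    rw [sub_add_sub_cancel]; rfl⟩

/-- The algebraic closure of `KInfty F` carries the unique extension of the absolute value. -/
instance normedFieldAlgClosure : NormedField (AlgebraicClosure (KInfty F)) :=
  spectralNorm.normedField (KInfty F) (AlgebraicClosure (KInfty F))

instance isUltrametricDistAlgClosure : IsUltrametricDist (AlgebraicClosure (KInfty F)) :=
  IsUltrametricDist.isUltrametricDist_of_forall_norm_add_le_max_norm
    (isNonarchimedean_spectralNorm (K := KInfty F) (L := AlgebraicClosure (KInfty F)))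

/-- `ℂ_∞`: the completion of an algebraic closure of the completion of `F(θ)` at infinity. -/
def CInfty : Type u := UniformSpace.Completion (AlgebraicClosure (KInfty F))

instance : NormedField (CInfty F) :=
  inferInstanceAs (NormedField (UniformSpace.Completion (AlgebraicClosure (KInfty F))))

instance : CompleteSpace (CInfty F) :=
  inferInstanceAs (CompleteSpace (UniformSpace.Completion (AlgebraicClosure (KInfty F))))

instance : Algebra (AlgebraicClosure (KInfty F)) (CInfty F) :=
  inferInstanceAs (Algebra (AlgebraicClosure (KInfty F))
    (UniformSpace.Completion (AlgebraicClosure (KInfty F))))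

theorem CInfty.norm_algebraMap (x : AlgebraicClosure (KInfty F)) :
    ‖algebraMap (AlgebraicClosure (KInfty F)) (CInfty F) x‖ = ‖x‖ :=
  UniformSpace.Completion.norm_coe x

/-- The embedding of `F(θ)` into `ℂ_∞`. -/
def ratFuncToCInfty : RatFunc F →+* CInfty F :=
  (algebraMap (AlgebraicClosure (KInfty F)) (CInfty F)).comp
    ((algebraMap (KInfty F) (AlgebraicClosure (KInfty F))).comp
      (algebraMap (RatFunc F) (KInfty F)))

instance : Algebra F (CInfty F) :=
  ((ratFuncToCInfty F).comp (algebraMap F (RatFunc F))).toAlgebra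

/-- The element `θ` of `ℂ_∞`. -/
def theta : CInfty F := ratFuncToCInfty F RatFunc.X

instance : IsUltrametricDist (CInfty F) :=
  IsUltrametricDist.isUltrametricDist_of_forall_norm_add_le_max_norm fun x y ↦ by
    refine UniformSpace.Completion.induction_on₂
      (p := fun x y : CInfty F ↦ ‖x + y‖ ≤ max ‖x‖ ‖y‖) x y ?_ ?_
    · exact isClosed_le (continuous_norm.comp continuous_add)
        ((continuous_norm.comp continuous_fst).max (continuous_norm.comp continuous_snd))
    · intro a b
      have h := IsUltrametricDist.norm_add_le_max a b
      rw [← CInfty.norm_algebraMap, ← CInfty.norm_algebraMap F a, ← CInfty.norm_algebraMap F b,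
        map_add] at h
      exact h

variable {F}

open Classical in
/-- The valuation `ord` on `ℂ_∞` with `ord θ = -1` and `ord 0 = +∞`. -/
def ord (x : CInfty F) : EReal :=
  if x = 0 then ⊤ else ((-Real.logb (Fintype.card F) ‖x‖ : ℝ) : EReal)

theorem norm_theta : ‖theta F‖ = Fintype.card F := by
  rw [theta, ratFuncToCInfty, RingHom.comp_apply, RingHom.comp_apply, CInfty.norm_algebraMap,
    ← KInfty.norm_X]
  exact spectralNorm_extends _

theorem ord_theta : ord (theta F) = -1 := by
  have h : (1 : ℝ) < Fintype.card F := by exact_mod_cast Fintype.one_lt_card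
  have h0 : theta F ≠ 0 := by
    rw [← norm_ne_zero_iff, norm_theta]; positivity
  rw [ord, if_neg h0, norm_theta, Real.logb_self_eq_one h]
  simp

end Field

/-! ### The Anderson ring and the modules `M(A)` -/

section Ring

variable (F : Type u) [Field F] [Fintype F]

/-- The `q`-Frobenius `a ↦ a ^ q` of `ℂ_∞`. -/
def frob : CInfty F →+* CInfty F := (FiniteField.frobeniusAlgHom F (CInfty F)).toRingHom

theorem frob_apply (a : CInfty F) : frob F a = a ^ Fintype.card F := rfl

/-- The powers of the Frobenius, as the action that twists the skew polynomial ring. -/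
instance : MulSemiringAction (Multiplicative ℕ) (CInfty F) :=
  MulSemiringAction.compHom (CInfty F) (powersHom (CInfty F →+* CInfty F) (frob F))

/-- `ℂ_∞{τ}`: skew polynomials in `τ` with `τ a = a ^ q τ`. -/
abbrev TauRing : Type u := SkewPolynomial (CInfty F)

/-- The constant `a` of `ℂ_∞{τ}`. -/
abbrev tauC (a : CInfty F) : TauRing F := SkewPolynomial.CRingHom a

/-- The element `τ` of `ℂ_∞{τ}`. -/
abbrev tau : TauRing F := SkewPolynomial.X

theorem tau_mul_tauC (a : CInfty F) : tau F * tauC F a = tauC F (a ^ Fintype.card F) * tau F := by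
  have h : (SkewPolynomial.φ : CInfty F →+* CInfty F) a = a ^ Fintype.card F := by
    rw [← frob_apply]
    simp only [MulSemiringAction.toRingHom_apply]
    change (powersHom (CInfty F →+* CInfty F) (frob F)) (Multiplicative.ofAdd 1) • a = _
    simp
  rw [tauC, tauC, tau, SkewPolynomial.CRingHom_eq_C, SkewPolynomial.CRingHom_eq_C,
    ← SkewPolynomial.monomial_one_one_eq_X, SkewPolynomial.monomial_mul_C,
    SkewPolynomial.C_mul_monomial]
  simp [h]

/-- The Anderson ring `ℂ_∞[T, τ]`: polynomials in a central variable `T` over `ℂ_∞{τ}`. -/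
abbrev AndersonRing : Type u := (TauRing F)[X]

/-- The inclusion `ℂ_∞[T] ⊆ ℂ_∞[T, τ]`. -/
def polyToAnderson : (CInfty F)[X] →+* AndersonRing F :=
  Polynomial.mapRingHom SkewPolynomial.CRingHom

/-- The Frobenius twist of `ℂ_∞[T]`: `q`-th powers on coefficients, `T ↦ T`. -/
def polyFrob : (CInfty F)[X] →+* (CInfty F)[X] := Polynomial.mapRingHom (frob F)

theorem tau_mul_poly (f : (CInfty F)[X]) :
    Polynomial.C (tau F) * polyToAnderson F f =
      polyToAnderson F (polyFrob F f) * Polynomial.C (tau F) := by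
  ext1 n
  simp only [polyToAnderson, polyFrob, Polynomial.coe_mapRingHom, Polynomial.coeff_C_mul,
    Polynomial.coeff_mul_C, Polynomial.coeff_map]
  exact tau_mul_tauC F _

variable {F} {n : ℕ}

/-- The matrix `θ + A τ + τ²` over `ℂ_∞{τ}`. -/
def motiveMatrix (A : Matrix (Fin n) (Fin n) (CInfty F)) : Matrix (Fin n) (Fin n) (TauRing F) :=
  Matrix.diagonal (fun _ ↦ tauC F (theta F)) + A.map (fun a ↦ tauC F a * tau F) +
    Matrix.diagonal (fun _ ↦ tau F ^ 2)

/-- The left `ℂ_∞[T, τ]`-module `M(A)`: the free left `ℂ_∞{τ}`-module with basis `e_1, …, e_n`, an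
element `∑ v_i e_i` being the row vector `v`, on which `T` acts by the `ℂ_∞{τ}`-linear map with
`T e_i = θ e_i + ∑ j, A i j τ e_j + τ² e_i`. -/
def TMotive (_A : Matrix (Fin n) (Fin n) (CInfty F)) : Type u := Fin n → TauRing F

instance (A : Matrix (Fin n) (Fin n) (CInfty F)) : AddCommGroup (TMotive A) :=
  inferInstanceAs (AddCommGroup (Fin n → TauRing F))

/-- The ring homomorphism that gives the action of `ℂ_∞[T, τ]` on `M(A)`. -/
def actionHom (A : Matrix (Fin n) (Fin n) (CInfty F)) :
    AndersonRing F →+* AddMonoid.End (Fin n → TauRing F) :=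
  Polynomial.eval₂RingHom' (Module.toAddMonoidEnd (TauRing F) (Fin n → TauRing F))
    (Matrix.vecMulLinear (motiveMatrix A)).toAddMonoidHom
    (fun a ↦ by
      ext1 v
      exact ((Matrix.vecMulLinear (motiveMatrix A)).map_smul a v).symm)

instance (A : Matrix (Fin n) (Fin n) (CInfty F)) : Module (AndersonRing F) (TMotive A) :=
  Module.compHom (Fin n → TauRing F) (actionHom A)

/-- The basis element `e_i` of `M(A)`. -/
def TMotive.e (A : Matrix (Fin n) (Fin n) (CInfty F)) (i : Fin n) : TMotive A :=
  (Pi.single i 1 : Fin n → TauRing F)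

theorem actionHom_X (A : Matrix (Fin n) (Fin n) (CInfty F)) (v : Fin n → TauRing F) :
    actionHom A Polynomial.X v = Matrix.vecMul v (motiveMatrix A) :=
  DFunLike.congr_fun (Polynomial.eval₂_X (Module.toAddMonoidEnd (TauRing F) (Fin n → TauRing F))
    ((Matrix.vecMulLinear (motiveMatrix A)).toAddMonoidHom : AddMonoid.End _)) v

theorem actionHom_C (A : Matrix (Fin n) (Fin n) (CInfty F)) (a : TauRing F)
    (v : Fin n → TauRing F) : actionHom A (Polynomial.C a) v = a • v :=
  DFunLike.congr_fun (Polynomial.eval₂_C (Module.toAddMonoidEnd (TauRing F) (Fin n → TauRing F))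
    ((Matrix.vecMulLinear (motiveMatrix A)).toAddMonoidHom : AddMonoid.End _)) v

/-- The defining relation `T e = θ e + A τ e + τ² e`. -/
theorem TMotive.T_smul_e (A : Matrix (Fin n) (Fin n) (CInfty F)) (i : Fin n) :
    (Polynomial.X : AndersonRing F) • TMotive.e A i =
      (Polynomial.C (tauC F (theta F)) : AndersonRing F) • TMotive.e A i +
      ∑ j, (Polynomial.C (tauC F (A i j) * tau F) : AndersonRing F) • TMotive.e A j +
      (Polynomial.C (tau F ^ 2) : AndersonRing F) • TMotive.e A i := by
  let e (j : Fin n) : Fin n → TauRing F := Pi.single j 1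
  suffices h : actionHom A Polynomial.X (e i) =
      actionHom A (Polynomial.C (tauC F (theta F))) (e i) +
      ∑ j, actionHom A (Polynomial.C (tauC F (A i j) * tau F)) (e j) +
      actionHom A (Polynomial.C (tau F ^ 2)) (e i) from h
  simp only [actionHom_X, actionHom_C, e, Matrix.single_one_vecMul]
  funext k
  simp [motiveMatrix, Matrix.diagonal_apply, Pi.single_apply, Finset.sum_apply, eq_comm]

end Ring

/-! ### The cohomology `H¹` -/

section Cohomology

variable (F : Type u) [Field F] [Fintype F]

/-- `ℂ_∞{T}`: power series over `ℂ_∞` whose coefficients tend to zero. -/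
def TateRing : Type u := PowerSeries.IsRestricted.subring (R := CInfty F) 1

instance : CommRing (TateRing F) :=
  inferInstanceAs (CommRing (PowerSeries.IsRestricted.subring (R := CInfty F) 1))

theorem isRestricted_poly (f : (CInfty F)[X]) :
    (f : PowerSeries (CInfty F)) ∈ PowerSeries.IsRestricted.subring (R := CInfty F) 1 := by
  refine (PowerSeries.isRestricted_iff' 1 _).2 (tendsto_const_nhds.congr' ?_)
  filter_upwards [Filter.eventually_gt_atTop f.natDegree] with k hk
  simp [Polynomial.coeff_eq_zero_of_natDegree_lt hk]

instance : Algebra (CInfty F)[X] (TateRing F) :=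
  (Polynomial.coeToPowerSeries.ringHom.codRestrict
    (PowerSeries.IsRestricted.subring (R := CInfty F) 1) (isRestricted_poly F)).toAlgebra

theorem isRestricted_map_frob (f : PowerSeries (CInfty F))
    (hf : f ∈ PowerSeries.IsRestricted.subring (R := CInfty F) 1) :
    PowerSeries.map (frob F) f ∈ PowerSeries.IsRestricted.subring (R := CInfty F) 1 := by
  have h := (PowerSeries.isRestricted_iff' 1 f).1 hf
  refine (PowerSeries.isRestricted_iff' 1 _).2 ?_
  have h2 := h.pow (Fintype.card F)
  rw [zero_pow Fintype.card_ne_zero] at h2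
  simpa [frob_apply] using h2

/-- The action of `τ` on `ℂ_∞{T}`: `∑ a_i T ^ i ↦ ∑ a_i ^ q T ^ i`. -/
def tateFrob : TateRing F →+* TateRing F :=
  ((PowerSeries.map (frob F)).comp
    (PowerSeries.IsRestricted.subring (R := CInfty F) 1).subtype).codRestrict
    (PowerSeries.IsRestricted.subring (R := CInfty F) 1)
    (fun f ↦ isRestricted_map_frob F f.1 f.2)

theorem tateFrob_algebraMap (f : (CInfty F)[X]) :
    tateFrob F (algebraMap (CInfty F)[X] (TateRing F) f) =
      algebraMap (CInfty F)[X] (TateRing F) (polyFrob F f) := by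
  refine Subtype.ext (PowerSeries.ext fun k ↦ ?_)
  change PowerSeries.coeff k (PowerSeries.map (frob F) (f : PowerSeries (CInfty F))) =
    PowerSeries.coeff k ((polyFrob F f : (CInfty F)[X]) : PowerSeries (CInfty F))
  simp [polyFrob]

/-- `τ` on `ℂ_∞{T}`, as a semilinear map. -/
def tateTau : TateRing F →ₛₗ[polyFrob F] TateRing F where
  toFun := tateFrob F
  map_add' := map_add _
  map_smul' f g := by
    rw [Algebra.smul_def, Algebra.smul_def, map_mul, tateFrob_algebraMap]

variable (M : Type u) [AddCommGroup M] [Module (AndersonRing F) M]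

/-- A `ℂ_∞[T, τ]`-module, seen as a `ℂ_∞[T]`-module. -/
abbrev polyModule : Module (CInfty F)[X] M := Module.compHom M (polyToAnderson F)

attribute [local instance] polyModule

/-- `τ` on a `ℂ_∞[T, τ]`-module, as a semilinear map over `ℂ_∞[T]`. -/
def moduleTau : M →ₛₗ[polyFrob F] M where
  toFun m := (Polynomial.C (tau F) : AndersonRing F) • m
  map_add' := smul_add _
  map_smul' f m := by
    change (Polynomial.C (tau F) : AndersonRing F) • polyToAnderson F f • m =
      polyToAnderson F (polyFrob F f) • (Polynomial.C (tau F) : AndersonRing F) • m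
    rw [smul_smul, smul_smul, tau_mul_poly]

/-- `M{T} = M ⊗_{ℂ_∞[T]} ℂ_∞{T}`. -/
def TateModule : Type u := M ⊗[(CInfty F)[X]] TateRing F

instance : AddCommGroup (TateModule F M) :=
  inferInstanceAs (AddCommGroup (M ⊗[(CInfty F)[X]] TateRing F))

instance : Module (CInfty F)[X] (TateModule F M) :=
  inferInstanceAs (Module (CInfty F)[X] (M ⊗[(CInfty F)[X]] TateRing F))

instance : Module F[X] (TateModule F M) :=
  Module.compHom (TateModule F M) (Polynomial.mapRingHom (algebraMap F (CInfty F)))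

/-- The action of `τ` on `M{T}`: `τ (m ⊗ f) = τ m ⊗ τ f`. -/
def tateModuleTau : TateModule F M →ₛₗ[polyFrob F] TateModule F M :=
  TensorProduct.map (moduleTau F M) (tateTau F)

theorem polyFrob_map (f : F[X]) :
    polyFrob F (f.map (algebraMap F (CInfty F))) = f.map (algebraMap F (CInfty F)) := by
  ext k
  simp [polyFrob, frob_apply, ← map_pow, FiniteField.pow_card]

/-- `H¹(M)`: the `τ`-invariant elements of `M{T}`, as an `F_q[T]`-module. -/
def H1 : Submodule F[X] (TateModule F M) where
  carrier := {x | tateModuleTau F M x = x}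
  add_mem' {x y} hx hy := by
    change tateModuleTau F M (x + y) = x + y
    rw [map_add, show tateModuleTau F M x = x from hx, show tateModuleTau F M y = y from hy]
  zero_mem' := map_zero _
  smul_mem' f x hx := by
    change tateModuleTau F M (f.map (algebraMap F (CInfty F)) • x) =
      f.map (algebraMap F (CInfty F)) • x
    rw [LinearMap.map_smulₛₗ, polyFrob_map, show tateModuleTau F M x = x from hx]

/-- `h¹(M)`, the rank of `H¹(M)` over `F_q[T]`. -/
def h1 : Cardinal.{u} := Module.rank F[X] (H1 F M)

/-- `M` is uniformizable if `h¹(M)` is the rank of `M` over `ℂ_∞[T]`. -/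
def IsUniformizable : Prop := h1 F M = Module.rank (CInfty F)[X] M

end Cohomology

end AndersonMotive

end

open AndersonMotive

/-! Over `ℂ_∞[T]` the module `M(A)` has the basis `e_i`, `τ e_i`. A `τ`-invariant element is
determined by its coordinates at the `τ e_i`. If `z_k` is the vector of their coefficients at `T^k`,
invariance becomes the recursion `L(z_0) = 0`, `L(z_{k+1}) = z_k^(q²)`, where `L` is the `F`-linear
operator `recOp A`, and membership in the Tate module means `z_k → 0`. So `H¹` is the space of null
chains of `L`, and multiplication by `T` shifts a chain.

The first non-zero term of a chain lies in `ker L`, while the late terms lie in a small ball on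
which `L` is injective. A dimension count then gives `h¹ ≤ dim ker L` (`h1_le_finrank_ker`).
Equality holds if every kernel element starts some null chain (`finrank_ker_le_h1`). For
off-diagonal `A` the kernel has `q⁴` elements, hence dimension 4.

Write `a = a₁₂`, `b = a₂₁`, `C = a / a^(q²)`. For `a ≠ 0`, eliminating the first component turns the
system into a two-step recursion for the second one, with left side `y + P y^(q²) + R y^(q⁴)`. Since
`ℂ_∞` is algebraically closed and ultrametric, it can be solved at each step by a smallest root, for
which no term on the left exceeds the right side. The size of the largest term then contracts,
provided the coefficient `1 + C` on the right is dominated by `P` or, with suitable exponents, by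
`R`. This is exactly where the bounds on `a` and `b` enter (`norm_one_add_elimC_lt`). For `a = 0`
the system is triangular and is solved one component at a time.

For sharpness, take `a^(q-1) = θ⁻¹` and `b = θ^q / a^q`, so that two terms of `P` cancel. After the
rescaling `y = a η`, a non-zero kernel element has `‖x‖ = ‖η‖ = 1`, and the recursion preserves
these equalities. No non-zero chain tends to zero, and `H¹ = 0` (`h1_critical_eq_zero`). -/

namespace AndersonMotive

/-! ### `ℂ_∞` is algebraically closed -/

section AlgClosed

open Polynomial

/-- A complete ultrametric field with a dense algebraically closed subfield is algebraically
closed, in every characteristic. -/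
theorem isAlgClosed_of_denseRange {K L : Type*} [Field K] [NontriviallyNormedField L]
    [CompleteSpace L] [IsUltrametricDist L] [Algebra K L]
    (hi : DenseRange (algebraMap K L)) [IsAlgClosed K] : IsAlgClosed L := by
  apply IsAlgClosed.of_exists_root
  intro f fmon firr
  have fnatdeg0 : f.natDegree ≠ 0 := (Irreducible.natDegree_pos firr).ne'
  let E := f.SplittingField
  let : NormedField E := spectralNorm.normedField L E
  let : NormedAlgebra L E := spectralNorm.normedAlgebra L E
  have hdeg : (f.map (algebraMap L E)).degree ≠ 0 := by
    simpa using degree_ne_of_natDegree_ne fnatdeg0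
  let a := rootOfSplits (SplittingField.splits f) hdeg
  have fa0 : f.aeval a = 0 := by
    rw [← eval_map_algebraMap]
    exact eval_rootOfSplits (Polynomial.SplittingField.splits f) hdeg
  -- `L` is complete, hence closed in the splitting field, so it is enough to approximate the root
  -- `a` by elements of `L`. These are roots of polynomials over `K` with coefficients close to
  -- those of `f`.
  have hclosed : IsClosed (Set.range (algebraMap L E)) :=
    (algebraMap_isometry L E).isClosedEmbedding.isClosed_range
  have ha : a ∈ closure (Set.range (algebraMap L E)) := by
    refine Metric.mem_closure_iff.2 fun δ δpos ↦ ?_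
    -- This tolerance on the coefficients inverts the bound on the displacement of a root, so that
    -- the displacement comes out below `δ`.
    have hε : (δ / (max ‖a‖ 1)) ^ f.natDegree / (f.natDegree + 1) > 0 := by positivity
    obtain ⟨g, gmon, gdeg, gcoeff⟩ :=
      exists_monic_and_natDegree_eq_and_norm_map_algebraMap_coeff_sub_lt hi fmon hε
    obtain ⟨b, hb, hab⟩ := exists_aroots_norm_sub_lt_of_norm_coeff_sub_lt
        hε fa0 fmon (gmon.map _) (gdeg ▸ (g.natDegree_map _)) gcoeff
        (by simpa [Polynomial.map_map] using (IsAlgClosed.splits g).map ((algebraMap L E).comp _))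
    have hab : ‖a - b‖ < δ := by
      rw [← Real.rpow_natCast, ← mul_comm_div, div_self, one_mul,
          ← Real.rpow_mul (div_pos δpos (by positivity)).le, mul_inv_cancel₀] at hab
      · simpa [mul_assoc, div_mul_cancel₀ _ (by positivity : (max ‖a‖ 1) > 0).ne'] using hab
      · simp [fnatdeg0]
      · positivity
    rw [Polynomial.aroots_def, Splits.roots_map ((IsAlgClosed.splits g).map _),
        Multiset.mem_map] at hb
    obtain ⟨c, _, rfl⟩ := hb
    exact ⟨_, ⟨c, rfl⟩, by rwa [dist_eq_norm]⟩
  obtain ⟨c, hc⟩ := hclosed.closure_eq ▸ ha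
  refine ⟨c, (algebraMap L E).injective ?_⟩
  rwa [← Polynomial.aeval_algebraMap_apply_eq_algebraMap_eval, hc, map_zero]

instance (F : Type*) [Field F] [Fintype F] : IsAlgClosed (CInfty F) :=
  letI : NontriviallyNormedField (CInfty F) :=
    { (inferInstance : NormedField (CInfty F)) with
      non_trivial := ⟨theta F, by rw [norm_theta]; exact_mod_cast Fintype.one_lt_card⟩ }
  isAlgClosed_of_denseRange (K := AlgebraicClosure (KInfty F))
    (UniformSpace.Completion.denseRange_coe (α := AlgebraicClosure (KInfty F)))

end AlgClosed

/-! ### Newton polygon: the smallest root of a polynomial -/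

section Roots

open Polynomial

variable {K : Type*} [NormedField K] [IsUltrametricDist K]

/-- Up to sign, the coefficient is a sum of products of all but `i` of the roots, and each of the
`i` omitted roots has norm at least `ρ`. -/
theorem norm_coeff_prod_X_sub_C_mul_pow_le {ρ : ℝ} (hρ : 0 ≤ ρ) (s : Multiset K)
    (hs : ∀ a ∈ s, ρ ≤ ‖a‖) (i : ℕ) :
    ‖((s.map fun a ↦ X - C a).prod).coeff i‖ * ρ ^ i ≤ (s.map fun a ↦ ‖a‖).prod := by
  induction s using Multiset.induction_on generalizing i with
  | empty =>
    rcases i with _ | i <;> simp [coeff_one]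
  | cons a s ih =>
    have hs' : ∀ b ∈ s, ρ ≤ ‖b‖ := fun b hb ↦ hs b (Multiset.mem_cons_of_mem hb)
    have ha : ρ ≤ ‖a‖ := hs a (Multiset.mem_cons_self a s)
    have hprod : 0 ≤ (s.map fun a ↦ ‖a‖).prod :=
      Multiset.prod_nonneg fun x hx ↦ by
        obtain ⟨b, -, rfl⟩ := Multiset.mem_map.1 hx
        exact norm_nonneg b
    simp only [Multiset.map_cons, Multiset.prod_cons]
    set g := (s.map fun a ↦ X - C a).prod
    rcases i with _ | i
    · have := ih hs' 0
      simp only [pow_zero, mul_one] at this ⊢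
      simp only [mul_coeff_zero, coeff_sub, coeff_X_zero, coeff_C_zero, zero_sub, norm_mul,
        norm_neg]
      gcongr
    · have h1 := ih hs' i
      have h2 := ih hs' (i + 1)
      have h3 : ((X - C a) * g).coeff (i + 1) = g.coeff i + -(a * g.coeff (i + 1)) := by
        rw [sub_mul, coeff_sub, coeff_X_mul, coeff_C_mul, sub_eq_add_neg]
      rw [h3]
      refine (mul_le_mul_of_nonneg_right (IsUltrametricDist.norm_add_le_max _ _)
        (by positivity)).trans ?_
      rw [max_mul_of_nonneg _ _ (by positivity), norm_neg, norm_mul]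
      refine max_le ?_ ?_
      · calc ‖g.coeff i‖ * ρ ^ (i + 1) = ρ * (‖g.coeff i‖ * ρ ^ i) := by ring
          _ ≤ ‖a‖ * (s.map fun a ↦ ‖a‖).prod := by gcongr
      · calc ‖a‖ * ‖g.coeff (i + 1)‖ * ρ ^ (i + 1) = ‖a‖ * (‖g.coeff (i + 1)‖ * ρ ^ (i + 1)) := by
              ring
          _ ≤ ‖a‖ * (s.map fun a ↦ ‖a‖).prod := by gcongr

/-- A polynomial over an algebraically closed ultrametric field has a root `y` such that no term
of the polynomial at `y` exceeds the constant term. -/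
theorem exists_root_norm_coeff_mul_pow_le [IsAlgClosed K] (f : K[X]) (hf : 0 < f.natDegree) :
    ∃ y, f.IsRoot y ∧ ∀ i, ‖f.coeff i‖ * ‖y‖ ^ i ≤ ‖f.coeff 0‖ := by
  classical
  have hf0 : f ≠ 0 := by rintro rfl; simp at hf
  have hsplit := IsAlgClosed.splits f
  have hne : f.roots.toFinset.Nonempty := by
    obtain ⟨x, hx⟩ := IsAlgClosed.exists_root f (by
      rw [degree_eq_natDegree hf0]; exact_mod_cast hf.ne')
    exact ⟨x, by simpa [hf0] using hx⟩
  -- With `y` a root of least norm, the bound for products of linear factors applies with `ρ = ‖y‖`.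
  obtain ⟨y, hy, hmin⟩ := f.roots.toFinset.exists_min_image (fun x ↦ ‖x‖) hne
  refine ⟨y, (mem_roots hf0).1 (Multiset.mem_toFinset.1 hy), fun i ↦ ?_⟩
  have key := norm_coeff_prod_X_sub_C_mul_pow_le (norm_nonneg y) f.roots
    (fun a ha ↦ hmin a (Multiset.mem_toFinset.2 ha)) i
  have hfac := hsplit.eq_prod_roots
  have h0 : ‖f.coeff 0‖ = ‖f.leadingCoeff‖ * (f.roots.map fun a ↦ ‖a‖).prod := by
    conv_lhs => rw [hfac]
    rw [coeff_C_mul, norm_mul, coeff_zero_eq_eval_zero, eval_multiset_prod, Multiset.map_map]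
    congr 1
    refine (map_multiset_prod (normHom (α := K)) _).trans ?_
    rw [Multiset.map_map]
    simp
  rw [h0]
  conv_lhs => rw [hfac]
  rw [coeff_C_mul, norm_mul, mul_assoc]
  gcongr

end Roots

/-! ### Trinomial equations -/

section Trinomial

open Polynomial

variable {K : Type*} [NormedField K]

theorem coeff_trinomial (a b t : K) {m n : ℕ} (hm : 1 < m) (hn : m < n) :
    (C b * X ^ n + C a * X ^ m + X - C t).coeff n = b ∧
    (C b * X ^ n + C a * X ^ m + X - C t).coeff m = a ∧
    (C b * X ^ n + C a * X ^ m + X - C t).coeff 1 = 1 ∧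
    (C b * X ^ n + C a * X ^ m + X - C t).coeff 0 = -t := by
  have h1 : n ≠ 0 := by lia
  have h2 : m ≠ 0 := by lia
  refine ⟨?_, ?_, ?_, ?_⟩ <;>
  simp only [coeff_add, coeff_sub, coeff_C_mul, coeff_X_pow, coeff_X, coeff_C] <;>
  simp [hn.ne, hn.ne', hm.ne, (hm.trans hn).ne, h1, h2, h1.symm, h2.symm]

/-- The equation `y + a yᵐ + b yⁿ = t` has a solution none of whose terms exceeds `t`. -/
theorem exists_trinomial_eq [IsUltrametricDist K] [IsAlgClosed K] (a b t : K) {m n : ℕ}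
    (hm : 1 < m) (hn : m < n) :
    ∃ y : K, y + a * y ^ m + b * y ^ n = t ∧
      ‖y‖ ≤ ‖t‖ ∧ ‖a‖ * ‖y‖ ^ m ≤ ‖t‖ ∧ ‖b‖ * ‖y‖ ^ n ≤ ‖t‖ := by
  obtain ⟨hcn, hcm, hc1, hc0⟩ := coeff_trinomial a b t hm hn
  obtain ⟨y, hy, hle⟩ := exists_root_norm_coeff_mul_pow_le
    (C b * X ^ n + C a * X ^ m + X - C t)
    (lt_of_lt_of_le one_pos (le_natDegree_of_ne_zero (by rw [hc1]; exact one_ne_zero)))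
  have h1 := hle 1
  have h2 := hle m
  have h3 := hle n
  rw [hc0, norm_neg] at h1 h2 h3
  rw [hc1, norm_one, one_mul, pow_one] at h1
  rw [hcm] at h2
  rw [hcn] at h3
  refine ⟨y, ?_, h1, h2, h3⟩
  simp only [IsRoot.def, eval_sub, eval_add, eval_mul, eval_C, eval_pow, eval_X] at hy
  linear_combination hy

/-- If `m` and `n` vanish in `K` and `b ≠ 0` then `y + a yᵐ + b yⁿ = 0` has `n` solutions. -/
theorem ncard_trinomial_eq_zero [IsAlgClosed K] (a b : K) {m n : ℕ} (hm : 1 < m) (hn : m < n)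
    (hm0 : (m : K) = 0) (hn0 : (n : K) = 0) (hb : b ≠ 0) :
    {y : K | y + a * y ^ m + b * y ^ n = 0}.Finite ∧
      {y : K | y + a * y ^ m + b * y ^ n = 0}.ncard = n := by
  classical
  set f : K[X] := C b * X ^ n + C a * X ^ m + X with hf
  have hdeg : f.natDegree = n := by
    rw [hf]
    compute_degree!
    · have h1 : n ≠ 1 := by lia
      simp [hn.ne', hb, h1.symm]
    all_goals lia
  -- Derivative 1 makes `f` separable, so its `n` roots are distinct.
  have hder : derivative f = 1 := by
    simp [hf, hm0, hn0, derivative_X_pow]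
  have hf0 : f ≠ 0 := by
    intro h; rw [h] at hder; simp at hder
  have hsep : f.Separable := by
    rw [separable_def, hder]; exact isCoprime_one_right
  have hset : {y : K | y + a * y ^ m + b * y ^ n = 0} = (f.roots.toFinset : Set K) := by
    ext y
    rw [Finset.mem_coe, Multiset.mem_toFinset, mem_roots hf0, IsRoot.def]
    simp only [hf, eval_add, eval_mul, eval_C, eval_pow, eval_X]
    change y + a * y ^ m + b * y ^ n = 0 ↔ _
    exact ⟨fun h ↦ by linear_combination h, fun h ↦ by linear_combination h⟩
  rw [hset]
  refine ⟨Finset.finite_toSet _, ?_⟩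
  rw [Set.ncard_coe_finset, Multiset.toFinset_card_of_nodup (nodup_roots hsep),
    ← (IsAlgClosed.splits f).natDegree_eq_card_roots, hdeg]

end Trinomial

/-! ### Rank over `F[X]` from coefficient maps -/

section Rank

open Polynomial

variable {F H V : Type*} [Field F] [AddCommGroup H] [Module F[X] H] [AddCommGroup V] [Module F V]

/-- The hypotheses let `c i` behave like the `i`-th coefficient of a power series, so the action of
a polynomial is a Cauchy product. -/
theorem coeffHom_smul (c : ℕ → H →+ V) (hC : ∀ i (a : F) h, c i (C a • h) = a • c i h)
    (h0 : ∀ h, c 0 ((X : F[X]) • h) = 0) (hS : ∀ i h, c (i + 1) ((X : F[X]) • h) = c i h)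
    (i : ℕ) (p : F[X]) (h : H) :
    c i (p • h) = ∑ k ∈ Finset.range (i + 1), p.coeff k • c (i - k) h := by
  have hX : ∀ k i, c i ((X ^ k : F[X]) • h) = if k ≤ i then c (i - k) h else 0 := by
    intro k
    induction k with
    | zero => intro i; simp
    | succ k ih =>
      rintro (_ | i)
      · rw [pow_succ', mul_smul, h0]; simp
      · rw [pow_succ', mul_smul, hS, ih]; simp
  induction p using Polynomial.induction_on' with
  | add p q hp hq => simp [add_smul, hp, hq, Finset.sum_add_distrib]
  | monomial n a =>
    rw [← C_mul_X_pow_eq_monomial, mul_smul, hC, hX]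
    simp only [coeff_C_mul, coeff_X_pow, mul_ite, mul_one, mul_zero, ite_smul, zero_smul]
    rw [Finset.sum_ite_eq']
    simp

/-- In a relation `∑ p_j h_j = 0` whose coefficients of degree below `k` all vanish, the `k`-th
coefficient reads `∑ p_j[k] c_0(h_j) = 0`. -/
theorem linearIndependent_of_coeffHom_zero (c : ℕ → H →+ V)
    (hC : ∀ i (a : F) h, c i (C a • h) = a • c i h)
    (h0 : ∀ h, c 0 ((X : F[X]) • h) = 0) (hS : ∀ i h, c (i + 1) ((X : F[X]) • h) = c i h)
    {ι : Type*} [Fintype ι] (h : ι → H) (hind : LinearIndependent F fun j ↦ c 0 (h j)) :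
    LinearIndependent F[X] h := by
  rw [Fintype.linearIndependent_iff] at hind ⊢
  intro p hp
  have key : ∀ k j, (p j).coeff k = 0 := by
    intro k
    induction k using Nat.strong_induction_on with
    | _ k ih =>
      refine hind (fun j ↦ (p j).coeff k) ?_
      have h1 := congrArg (c k) hp
      rw [map_sum, map_zero] at h1
      rw [← h1]
      refine Finset.sum_congr rfl fun j _ ↦ ?_
      rw [coeffHom_smul c hC h0 hS, Finset.sum_eq_single_of_mem k (by simp)]
      · simp
      · intro l hl hlk
        rw [ih l (by simp at hl; lia), zero_smul]
  exact fun j ↦ Polynomial.ext fun k ↦ by simp [key k j]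

/-- Each of the first `m` successive vanishing conditions costs at most the dimension of `W`. -/
theorem finrank_le_add_mul_of_mem {P : Type*} [AddCommGroup P] [Module F P]
    [FiniteDimensional F P] (L : ℕ → P →ₗ[F] V) (W : Submodule F V) [FiniteDimensional F W]
    (hW : ∀ p n, (∀ i < n, L i p = 0) → L n p ∈ W) (m : ℕ) :
    Module.finrank F P ≤
      Module.finrank F (⨅ i ∈ Finset.range m, LinearMap.ker (L i) : Submodule F P) +
        Module.finrank F W * m := by
  set Q : ℕ → Submodule F P := fun m ↦ ⨅ i ∈ Finset.range m, LinearMap.ker (L i)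
  have hQ : ∀ m p, p ∈ Q m ↔ ∀ i < m, L i p = 0 := by
    intro m p
    simp only [Q, Submodule.mem_iInf, Finset.mem_range, LinearMap.mem_ker]
  change _ ≤ Module.finrank F (Q m) + _
  induction m with
  | zero =>
    have : Q 0 = ⊤ := by simp [Q]
    rw [this, finrank_top]; lia
  | succ m ih =>
    let f : Q m →ₗ[F] W := ((L m).comp (Q m).subtype).codRestrict W fun p ↦
      hW _ _ ((hQ m p).1 p.2)
    have h1 := LinearMap.finrank_range_add_finrank_ker f
    have h2 : Module.finrank F (LinearMap.range f) ≤ Module.finrank F W := Submodule.finrank_le _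
    have h3 : Module.finrank F (LinearMap.ker f) ≤ Module.finrank F (Q (m + 1)) := by
      rw [← Submodule.finrank_map_subtype_eq]
      refine Submodule.finrank_mono ?_
      rintro _ ⟨p, hp, rfl⟩
      refine (hQ _ _).2 fun i hi ↦ ?_
      rcases Nat.lt_succ_iff_lt_or_eq.1 hi with hi | rfl
      · exact (hQ m _).1 p.2 i hi
      · exact congrArg Subtype.val (LinearMap.mem_ker.1 hp)
    rw [mul_add_one]
    lia

/-- Suppose that the first non-zero coefficient of each element of `H` lies in a space `W` of
finite dimension, and that all but finitely many coefficients lie in a subspace `B` with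
`B ∩ W = 0`. Then the rank of `H` is at most the dimension of `W`. -/
theorem rank_le_of_coeffHom (c : ℕ → H →+ V)
    (hC : ∀ i (a : F) h, c i (C a • h) = a • c i h)
    (h0 : ∀ h, c 0 ((X : F[X]) • h) = 0) (hS : ∀ i h, c (i + 1) ((X : F[X]) • h) = c i h)
    (hinj : ∀ h, (∀ i, c i h = 0) → h = 0)
    (W B : Submodule F V) [FiniteDimensional F W] (hWB : ∀ v ∈ W, v ∈ B → v = 0)
    (hW : ∀ h n, (∀ i < n, c i h = 0) → c n h ∈ W)
    (hB : ∀ h, ∃ k, ∀ i, k ≤ i → c i h ∈ B) :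
    Module.rank F[X] H ≤ Module.finrank F W := by
  classical
  refine rank_le fun s hs ↦ ?_
  by_contra! hcard
  set d := Module.finrank F W
  obtain ⟨K, hK⟩ : ∃ K, ∀ h ∈ s, ∀ i, K ≤ i → c i h ∈ B := by
    choose k hk using hB
    exact ⟨s.sup k, fun h hh i hi ↦ hk h i ((Finset.le_sup (f := k) hh).trans hi)⟩
  -- Combinations of more than `d` elements with polynomial coefficients of degree below `N` form a
  -- space of dimension at least `(d + 1) N`. This exceeds `d (N + K)`, the cost of killing the
  -- first `N + K` coefficients.
  set N := d * K + 1
  let w : (s → degreeLT F N) → H := fun p ↦ ∑ j, (p j : F[X]) • (j : H)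
  have hw : ∀ i p, c i (w p) =
      ∑ j, ∑ k ∈ Finset.range (i + 1), ((p j : F[X])).coeff k • c (i - k) (j : H) := by
    intro i p
    rw [map_sum]
    exact Finset.sum_congr rfl fun j _ ↦ coeffHom_smul c hC h0 hS i _ _
  let L : ℕ → (s → degreeLT F N) →ₗ[F] V := fun i ↦
    { toFun := fun p ↦ c i (w p)
      map_add' := fun p q ↦ by
        simp only [w, Pi.add_apply, Submodule.coe_add, add_smul, Finset.sum_add_distrib, map_add]
      map_smul' := fun a p ↦ by
        simp only [hw, Pi.smul_apply, Submodule.coe_smul, coeff_smul, smul_assoc,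
          Finset.smul_sum, RingHom.id_apply] }
  let Q : ℕ → Submodule F (s → degreeLT F N) := fun m ↦ ⨅ i ∈ Finset.range m, LinearMap.ker (L i)
  have hQ : ∀ m p, p ∈ Q m ↔ ∀ i < m, c i (w p) = 0 := by
    intro m p
    simp only [Q, Submodule.mem_iInf, Finset.mem_range, LinearMap.mem_ker]
    rfl
  have : FiniteDimensional F (degreeLT F N) :=
    Module.Finite.equiv (degreeLTEquiv F N).symm
  have hstep := finrank_le_add_mul_of_mem L W (fun p n hp ↦ hW _ _ hp)
  have hP : Module.finrank F (s → degreeLT F N) = s.card * N := by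
    rw [Module.finrank_pi_fintype]
    simp [(degreeLTEquiv F N).finrank_eq]
  have hpos : 0 < Module.finrank F (Q (N + K)) := by
    have arith : ∀ n e : ℕ, d < n → n * N ≤ e + d * (N + K) → 0 < e := by
      intro n e hn he
      have h2 : (d + 1) * N ≤ n * N := Nat.mul_le_mul_right _ hn
      have h3 : (d + 1) * N = d * N + (d * K + 1) := by ring
      have h4 : d * (N + K) = d * N + d * K := by ring
      lia
    refine arith _ _ hcard ?_
    rw [← hP]
    exact hstep (N + K)
  obtain ⟨p, hp⟩ := (Module.finrank_pos_iff_exists_ne_zero (R := F) (M := Q (N + K))).1 hpos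
  have hpQ := (hQ _ _).1 p.2
  have hvan : ∀ i, c i (w p.1) = 0 := by
    intro i
    induction i using Nat.strong_induction_on with
    | _ i ih =>
      rcases lt_or_ge i (N + K) with hi | hi
      · exact hpQ i hi
      -- From index `N + K` on, the coefficient of the combination only involves coefficients of
      -- index above `K` of the given elements. So it lies in `B`, and in `W` because all earlier
      -- ones vanish.
      · refine hWB _ (hW _ _ ih) ?_
        rw [hw]
        refine B.sum_mem fun j _ ↦ B.sum_mem fun k _ ↦ ?_
        by_cases hk : k < N
        · exact B.smul_mem _ (hK _ j.2 _ (by lia))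
        · have h1 : ((p.1 j : F[X])).coeff k = 0 :=
            coeff_eq_zero_of_degree_lt ((mem_degreeLT.1 (p.1 j).2).trans_le (by
              exact_mod_cast not_lt.1 hk))
          rw [h1, zero_smul]
          exact B.zero_mem
  refine hp (Subtype.ext (funext fun j ↦ Subtype.ext ?_))
  exact Fintype.linearIndependent_iff.1 hs (fun j ↦ (p.1 j : F[X])) (hinj _ hvan) j

end Rank

noncomputable section

/-! ### `M(A)` as a free module over `ℂ_∞[T]` -/

section Coordinates

variable {F : Type*} [Field F] [Fintype F] {n : ℕ}

attribute [local instance] polyModule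

variable (F n) in
/-- Coordinates of `M(A)` with respect to the elements `e_i` and the elements `τ e_i`. -/
abbrev Coord : Type _ := (Fin n → (CInfty F)[X]) × (Fin n → (CInfty F)[X])

/-- `τ` in the coordinates of `M(A)` with respect to `e_i`, `τ e_i`. -/
def coordTau (A : Matrix (Fin n) (Fin n) (CInfty F)) :
    Coord F n →ₛₗ[polyFrob F] Coord F n where
  toFun x := (fun i ↦ (Polynomial.X - Polynomial.C (theta F)) * polyFrob F (x.2 i),
    fun j ↦ polyFrob F (x.1 j) - ∑ i, Polynomial.C (A i j) * polyFrob F (x.2 i))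
  map_add' x y := by
    refine Prod.ext (funext fun i ↦ ?_) (funext fun i ↦ ?_)
    · simp [mul_add]
    · simp only [Prod.fst_add, Prod.snd_add, Pi.add_apply, map_add, mul_add,
        Finset.sum_add_distrib]
      ring
  map_smul' f x := by
    refine Prod.ext (funext fun i ↦ ?_) (funext fun i ↦ ?_)
    · simp only [Prod.smul_fst, Prod.smul_snd, Pi.smul_apply, smul_eq_mul, map_mul]
      ring
    · simp only [Prod.smul_fst, Prod.smul_snd, Pi.smul_apply, smul_eq_mul, map_mul, mul_sub,
        Finset.mul_sum]
      congr 1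
      exact Finset.sum_congr rfl fun j _ ↦ by ring

theorem ofAdd_smul_eq_iterate (k : ℕ) (a : CInfty F) :
    Multiplicative.ofAdd k • a = (frob F)^[k] a := by
  change (powersHom (CInfty F →+* CInfty F) (frob F)) (Multiplicative.ofAdd k) a = _
  rw [powersHom_apply, toAdd_ofAdd]
  exact congrFun (RingHom.coe_pow (frob F) k) a

/-- `τ` on the coordinates of `M(A)`, as an additive endomorphism. -/
def coordTauEnd (A : Matrix (Fin n) (Fin n) (CInfty F)) : AddMonoid.End (Coord F n) :=
  (coordTau A).toAddMonoidHom

/-- The action of `ℂ_∞{τ}` on the coordinates of `M(A)`. -/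
def coordAction (A : Matrix (Fin n) (Fin n) (CInfty F)) :
    TauRing F →+* AddMonoid.End (Coord F n) :=
  SkewMonoidAlgebra.liftNCRingHom
    ((Module.toAddMonoidEnd (CInfty F)[X] (Coord F n)).comp Polynomial.C)
    (powersHom (AddMonoid.End _) (coordTauEnd A))
    (by
      intro a y
      induction y using Multiplicative.rec with
      | ofAdd k =>
        rw [ofAdd_smul_eq_iterate]
        simp only [powersHom_apply, toAdd_ofAdd, RingHom.comp_apply]
        induction k with
        | zero => simp
        | succ k ih =>
          rw [pow_succ', Function.iterate_succ_apply', mul_assoc, ← ih, ← mul_assoc, ← mul_assoc]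
          congr 1
          ext1 x
          change Polynomial.C (frob F ((frob F)^[k] a)) • coordTau A x =
            coordTau A (Polynomial.C ((frob F)^[k] a) • x)
          rw [LinearMap.map_smulₛₗ]
          simp [polyFrob])

theorem coordAction_tauC (A : Matrix (Fin n) (Fin n) (CInfty F)) (a : CInfty F)
    (x : Coord F n) :
    coordAction A (tauC F a) x = Polynomial.C a • x := by
  have h : coordAction A (tauC F a) = _ * _ := SkewMonoidAlgebra.liftNC_single _ _ _ _
  rw [h, map_one, mul_one]
  rfl

theorem coordAction_tau (A : Matrix (Fin n) (Fin n) (CInfty F))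
    (x : Coord F n) :
    coordAction A (tau F) x = coordTau A x := by
  have h : coordAction A (tau F) = _ * _ := SkewMonoidAlgebra.liftNC_single _ _ _ _
  rw [h, powersHom_apply, toAdd_ofAdd, pow_one, AddMonoidHom.coe_coe, map_one, one_mul]
  rfl

theorem coordAction_add (A : Matrix (Fin n) (Fin n) (CInfty F)) (p r : TauRing F)
    (x : Coord F n) : coordAction A (p + r) x = coordAction A p x + coordAction A r x := by
  rw [map_add]; rfl

theorem coordAction_mul (A : Matrix (Fin n) (Fin n) (CInfty F)) (p r : TauRing F)
    (x : Coord F n) : coordAction A (p * r) x = coordAction A p (coordAction A r x) := by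
  rw [map_mul]; rfl

theorem coordAction_zero (A : Matrix (Fin n) (Fin n) (CInfty F)) (x : Coord F n) :
    coordAction A 0 x = 0 := by
  rw [map_zero]; rfl

theorem coordAction_sum (A : Matrix (Fin n) (Fin n) (CInfty F)) {ι : Type*} (s : Finset ι)
    (p : ι → TauRing F) (x : Coord F n) :
    coordAction A (∑ i ∈ s, p i) x = ∑ i ∈ s, coordAction A (p i) x := by
  classical
  induction s using Finset.induction_on with
  | empty => simp
  | insert i s hi ih => rw [Finset.sum_insert hi, Finset.sum_insert hi, coordAction_add, ih]

theorem tauRing_induction {motive : TauRing F → Prop} (p : TauRing F)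
    (hadd : ∀ p r, motive p → motive r → motive (p + r))
    (hmonomial : ∀ k a, motive (tauC F a * tau F ^ k)) : motive p := by
  induction p using SkewPolynomial.induction with
  | h0 => simpa using hmonomial 0 0
  | ha n b f _ _ h =>
    refine hadd _ _ ?_ h
    rw [← SkewPolynomial.C_mul_X_pow_eq_monomial]
    exact hmonomial n b

theorem coordAction_X_smul (A : Matrix (Fin n) (Fin n) (CInfty F)) (p : TauRing F)
    (x : Coord F n) :
    coordAction A p ((Polynomial.X : (CInfty F)[X]) • x) =
      (Polynomial.X : (CInfty F)[X]) • coordAction A p x := by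
  induction p using tauRing_induction with
  | hadd p r hp hr => simp only [coordAction_add, hp, hr, smul_add]
  | hmonomial k a =>
    have hk : ∀ k, coordAction A (tau F ^ k) ((Polynomial.X : (CInfty F)[X]) • x) =
        (Polynomial.X : (CInfty F)[X]) • coordAction A (tau F ^ k) x := by
      intro k
      induction k with
      | zero => simp
      | succ k ih =>
        rw [pow_succ', coordAction_mul, coordAction_mul, ih,
          coordAction_tau, coordAction_tau, LinearMap.map_smulₛₗ]
        simp [polyFrob]
    rw [coordAction_mul, coordAction_mul, hk, coordAction_tauC,
      coordAction_tauC, smul_comm]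

theorem C_smul_apply (A : Matrix (Fin n) (Fin n) (CInfty F)) (p : TauRing F) (v : TMotive A) :
    (Polynomial.C p : AndersonRing F) • v = (p • (show Fin n → TauRing F from v) :
      Fin n → TauRing F) :=
  actionHom_C A p v

theorem X_smul_apply (A : Matrix (Fin n) (Fin n) (CInfty F)) (v : TMotive A) :
    (Polynomial.X : AndersonRing F) • v =
      Matrix.vecMul (show Fin n → TauRing F from v) (motiveMatrix A) :=
  actionHom_X A v

/-- The coordinates of `e_i`. -/
def coordE (i : Fin n) : Coord F n := (Pi.single i 1, 0)

/-- The map that takes an element of `M(A)` to its coordinates. -/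
def toCoordHom (A : Matrix (Fin n) (Fin n) (CInfty F)) : (Fin n → TauRing F) →+ Coord F n where
  toFun v := ∑ i, coordAction A (v i) (coordE i)
  map_zero' := by simp
  map_add' v w := by
    simp only [Pi.add_apply, coordAction_add, Finset.sum_add_distrib]

theorem toCoordHom_apply (A : Matrix (Fin n) (Fin n) (CInfty F)) (v : Fin n → TauRing F) :
    toCoordHom A v = ∑ i, coordAction A (v i) (coordE i) := rfl

theorem coordTau_coordE (A : Matrix (Fin n) (Fin n) (CInfty F)) (i : Fin n) :
    coordTau A (coordE i) = (0, Pi.single i 1) := by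
  refine Prod.ext (funext fun j ↦ ?_) (funext fun j ↦ ?_)
  · simp [coordTau, coordE]
  · rcases eq_or_ne j i with rfl | h
    · simp [coordTau, coordE]
    · simp [coordTau, coordE, h]

theorem coordTau_coordTau_coordE (A : Matrix (Fin n) (Fin n) (CInfty F)) (i : Fin n) :
    coordTau A (0, Pi.single i 1) = ((Polynomial.X - Polynomial.C (theta F)) • Pi.single i 1,
      fun j ↦ - Polynomial.C (A i j)) := by
  have h : ∀ j, polyFrob F ((Pi.single i 1 : Fin n → (CInfty F)[X]) j) =
      (Pi.single i 1 : Fin n → (CInfty F)[X]) j := by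
    intro j
    rcases eq_or_ne j i with rfl | h
    · simp
    · simp [h]
  refine Prod.ext (funext fun j ↦ ?_) (funext fun j ↦ ?_)
  · simp [coordTau, h]
  · simp only [coordTau, LinearMap.coe_mk, AddHom.coe_mk, h]
    simp [Pi.single_apply]

/-- The defining relation of `M(A)` holds among the coordinate vectors. This makes the coordinate
map, built from the `ℂ_∞{τ}`-structure, linear in `T` as well. -/
theorem sum_coordAction_motiveMatrix (A : Matrix (Fin n) (Fin n) (CInfty F)) (j : Fin n) :
    ∑ i, coordAction A (motiveMatrix A j i) (coordE i) =
      (Polynomial.X : (CInfty F)[X]) • coordE j := by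
  have h1 : ∀ i, coordAction A (motiveMatrix A j i) (coordE i) =
      (if j = i then Polynomial.C (theta F) • coordE j else 0) +
      Polynomial.C (A j i) • ((0, Pi.single i 1) : Coord F n) +
      (if j = i then coordTau A (0, Pi.single j 1) else 0) := by
    intro i
    simp only [motiveMatrix, Matrix.add_apply, Matrix.diagonal_apply, Matrix.map_apply,
      coordAction_add, coordAction_mul, coordAction_tauC,
      coordAction_tau, coordTau_coordE]
    congr 1
    · congr 1
      split_ifs with h
      · subst h; rw [coordAction_tauC]
      · exact coordAction_zero A _
    · split_ifs with h
      · subst h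
        rw [pow_two, coordAction_mul, coordAction_tau, coordAction_tau,
          coordTau_coordE]
      · exact coordAction_zero A _
  simp only [h1, Finset.sum_add_distrib, Finset.sum_ite_eq, Finset.mem_univ, if_true]
  rw [coordTau_coordTau_coordE]
  refine Prod.ext ?_ ?_
  · simp [coordE, sub_smul, Prod.fst_sum]
  · funext k
    simp [coordE, Prod.snd_sum, Finset.sum_apply, Pi.single_apply]

theorem toCoordHom_vecMul (A : Matrix (Fin n) (Fin n) (CInfty F)) (v : Fin n → TauRing F) :
    toCoordHom A (Matrix.vecMul v (motiveMatrix A)) =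
      (Polynomial.X : (CInfty F)[X]) • toCoordHom A v := by
  simp only [toCoordHom_apply, Matrix.vecMul, dotProduct, coordAction_sum, coordAction_mul]
  rw [Finset.sum_comm, Finset.smul_sum]
  refine Finset.sum_congr rfl fun j _ ↦ ?_
  rw [← map_sum, sum_coordAction_motiveMatrix, coordAction_X_smul]

theorem toCoordHom_smul (A : Matrix (Fin n) (Fin n) (CInfty F)) (p : TauRing F)
    (v : Fin n → TauRing F) : toCoordHom A (p • v) = coordAction A p (toCoordHom A v) := by
  simp [toCoordHom_apply, map_sum]

/-- The `ℂ_∞[T]`-linear map that takes an element of `M(A)` to its coordinates. -/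
def toCoord (A : Matrix (Fin n) (Fin n) (CInfty F)) : TMotive A →ₗ[(CInfty F)[X]] Coord F n where
  toFun v := toCoordHom A v
  map_add' v w := map_add (toCoordHom A) v w
  map_smul' f v := by
    change toCoordHom A (polyToAnderson F f • v) = f • toCoordHom A v
    induction f using Polynomial.induction_on' generalizing v with
    | add f g hf hg =>
      rw [map_add, add_smul, add_smul, ← hf, ← hg]
      exact map_add (toCoordHom A) _ _
    | monomial k a =>
      have hk : ∀ k, ∀ v : TMotive A, toCoordHom A ((Polynomial.X ^ k : AndersonRing F) • v) =
          (Polynomial.X ^ k : (CInfty F)[X]) • toCoordHom A v := by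
        intro k
        induction k with
        | zero => intro v; simp
        | succ k ih =>
          intro v
          rw [pow_succ, mul_smul, ih, X_smul_apply, pow_succ, mul_smul]
          congr 1
          exact toCoordHom_vecMul A v
      rw [polyToAnderson, Polynomial.coe_mapRingHom, Polynomial.map_monomial,
        ← Polynomial.C_mul_X_pow_eq_monomial, ← Polynomial.C_mul_X_pow_eq_monomial, mul_smul,
        mul_smul, ← hk, C_smul_apply, ← coordAction_tauC A]
      exact toCoordHom_smul A _ _

theorem toCoord_apply (A : Matrix (Fin n) (Fin n) (CInfty F)) (v : TMotive A) :
    toCoord A v = ∑ i, coordAction A ((show Fin n → TauRing F from v) i) (coordE i) := rfl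

theorem toCoord_tau (A : Matrix (Fin n) (Fin n) (CInfty F)) (v : TMotive A) :
    toCoord A (moduleTau F (TMotive A) v) = coordTau A (toCoord A v) := by
  rw [← coordAction_tau]
  exact (congrArg (toCoordHom A) (C_smul_apply A (tau F) v)).trans (toCoordHom_smul A _ _)

/-- The element of `M(A)` with the given coordinates. -/
def ofCoord (A : Matrix (Fin n) (Fin n) (CInfty F)) : Coord F n →ₗ[(CInfty F)[X]] TMotive A :=
  (Fintype.linearCombination (CInfty F)[X] (TMotive.e A)).coprod
    (Fintype.linearCombination (CInfty F)[X] fun i ↦ moduleTau F (TMotive A) (TMotive.e A i))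

theorem ofCoord_coordE (A : Matrix (Fin n) (Fin n) (CInfty F)) (i : Fin n) :
    ofCoord A (coordE i) = TMotive.e A i := by
  simp [ofCoord, coordE, Fintype.linearCombination_apply_single]

theorem ofCoord_zero_single (A : Matrix (Fin n) (Fin n) (CInfty F)) (i : Fin n) :
    ofCoord A (0, Pi.single i 1) = moduleTau F (TMotive A) (TMotive.e A i) := by
  simp [ofCoord, Fintype.linearCombination_apply_single]

theorem toCoord_e (A : Matrix (Fin n) (Fin n) (CInfty F)) (i : Fin n) :
    toCoord A (TMotive.e A i) = coordE i := by
  rw [toCoord_apply, Finset.sum_eq_single i]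
  · simp [TMotive.e]
  · intro j _ hj
    simp [TMotive.e, hj]
  · simp

theorem coord_eq_sum (x : Coord F n) :
    x = ∑ i, x.1 i • coordE i + ∑ i, x.2 i • ((0, Pi.single i 1) : Coord F n) := by
  refine Prod.ext (funext fun k ↦ ?_) (funext fun k ↦ ?_)
  · simp [coordE, Prod.fst_sum, Finset.sum_apply, Pi.single_apply]
  · simp [coordE, Prod.snd_sum, Finset.sum_apply, Pi.single_apply]

theorem toCoord_ofCoord (A : Matrix (Fin n) (Fin n) (CInfty F)) (x : Coord F n) :
    toCoord A (ofCoord A x) = x := by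
  conv_lhs => rw [coord_eq_sum x]
  simp only [map_add, map_sum, map_smul, ofCoord_coordE, ofCoord_zero_single, toCoord_tau,
    toCoord_e, coordTau_coordE]
  exact (coord_eq_sum x).symm

theorem X_poly_smul (A : Matrix (Fin n) (Fin n) (CInfty F)) (v : TMotive A) :
    (Polynomial.X : (CInfty F)[X]) • v = (Polynomial.X : AndersonRing F) • v := by
  change polyToAnderson F Polynomial.X • v = _
  simp [polyToAnderson]

theorem C_poly_smul (A : Matrix (Fin n) (Fin n) (CInfty F)) (a : CInfty F) (v : TMotive A) :
    (Polynomial.C a : (CInfty F)[X]) • v = (Polynomial.C (tauC F a) : AndersonRing F) • v := by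
  change polyToAnderson F (Polynomial.C a) • v = _
  simp [polyToAnderson]

/-- This is the defining relation solved for `τ² e_i`. -/
theorem moduleTau_moduleTau_e (A : Matrix (Fin n) (Fin n) (CInfty F)) (i : Fin n) :
    moduleTau F (TMotive A) (moduleTau F (TMotive A) (TMotive.e A i)) =
      ofCoord A (coordTau A (0, Pi.single i 1)) := by
  have h := TMotive.T_smul_e A i
  have h1 : moduleTau F (TMotive A) (moduleTau F (TMotive A) (TMotive.e A i)) =
      (Polynomial.C (tau F ^ 2) : AndersonRing F) • TMotive.e A i := by
    rw [pow_two, Polynomial.C_mul, mul_smul]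
    rfl
  have h2 : ∀ j, (Polynomial.C (tauC F (A i j) * tau F) : AndersonRing F) • TMotive.e A j =
      (Polynomial.C (A i j) : (CInfty F)[X]) • moduleTau F (TMotive A) (TMotive.e A j) := by
    intro j
    rw [Polynomial.C_mul, mul_smul, C_poly_smul]
    rfl
  rw [← X_poly_smul, ← C_poly_smul, ← h1] at h
  simp only [h2] at h
  rw [coordTau_coordTau_coordE]
  rw [ofCoord, LinearMap.coprod_apply, map_smul, Fintype.linearCombination_apply_single, one_smul,
    Fintype.linearCombination_apply, sub_smul, h]
  simp only [neg_smul, Finset.sum_neg_distrib]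
  abel

theorem ofCoord_coordTau (A : Matrix (Fin n) (Fin n) (CInfty F)) (x : Coord F n) :
    ofCoord A (coordTau A x) = moduleTau F (TMotive A) (ofCoord A x) := by
  conv_lhs => rw [coord_eq_sum x]
  conv_rhs => rw [coord_eq_sum x]
  simp only [map_add, map_sum, LinearMap.map_smulₛₗ, map_smul, ofCoord_coordE,
    ofCoord_zero_single, coordTau_coordE, moduleTau_moduleTau_e]

/-- Since `M(A)` is generated by the `e_i` over `ℂ_∞{τ}`, this equivariance reduces `ofCoord ∘
toCoord = id` to the `e_i`. -/
theorem ofCoord_coordAction (A : Matrix (Fin n) (Fin n) (CInfty F)) (p : TauRing F)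
    (x : Coord F n) :
    ofCoord A (coordAction A p x) = (Polynomial.C p : AndersonRing F) • ofCoord A x := by
  induction p using tauRing_induction with
  | hadd p r hp hr => rw [coordAction_add, map_add, hp, hr, Polynomial.C_add, add_smul]
  | hmonomial k a =>
    have hk : ∀ k, ofCoord A (coordAction A (tau F ^ k) x) =
        (Polynomial.C (tau F ^ k) : AndersonRing F) • ofCoord A x := by
      intro k
      induction k with
      | zero => simp
      | succ k ih =>
        rw [pow_succ', coordAction_mul, coordAction_tau, ofCoord_coordTau, ih, Polynomial.C_mul,
          mul_smul]
        rfl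
    rw [coordAction_mul, coordAction_tauC, map_smul, hk, C_poly_smul, ← mul_smul,
      ← Polynomial.C_mul]

theorem ofCoord_toCoord (A : Matrix (Fin n) (Fin n) (CInfty F)) (v : TMotive A) :
    ofCoord A (toCoord A v) = v := by
  rw [toCoord_apply, map_sum]
  simp only [ofCoord_coordAction, ofCoord_coordE, C_smul_apply]
  let w : Fin n → TauRing F := v
  change (∑ i, w i • (Pi.single i 1 : Fin n → TauRing F)) = w
  funext j
  simp [Finset.sum_apply, Pi.single_apply]

/-- `M(A)` is free over `ℂ_∞[T]` with basis `e_i`, `τ e_i`. -/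
def motiveBasis (A : Matrix (Fin n) (Fin n) (CInfty F)) :
    Module.Basis (Fin n ⊕ Fin n) (CInfty F)[X] (TMotive A) :=
  Module.Basis.ofEquivFun ((LinearEquiv.ofLinearMap (toCoord A) (ofCoord A)
    (LinearMap.ext (toCoord_ofCoord A)) (LinearMap.ext (ofCoord_toCoord A))) ≪≫ₗ
    (LinearEquiv.sumArrowLequivProdArrow (Fin n) (Fin n) (CInfty F)[X] (CInfty F)[X]).symm)

theorem motiveBasis_repr_inl (A : Matrix (Fin n) (Fin n) (CInfty F)) (v : TMotive A) (i : Fin n) :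
    (motiveBasis A).repr v (Sum.inl i) = (toCoord A v).1 i := rfl

theorem motiveBasis_repr_inr (A : Matrix (Fin n) (Fin n) (CInfty F)) (v : TMotive A) (i : Fin n) :
    (motiveBasis A).repr v (Sum.inr i) = (toCoord A v).2 i := rfl

theorem rank_TMotive (A : Matrix (Fin n) (Fin n) (CInfty F)) :
    Module.rank (CInfty F)[X] (TMotive A) = (n + n : ℕ) := by
  rw [rank_eq_card_basis (motiveBasis A)]
  simp

end Coordinates

/-! ### Coordinates and coefficients on `M(A){T}` -/

section TateCoordinates

variable {F : Type*} [Field F] [Fintype F] {n : ℕ}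

attribute [local instance] polyModule

/-- Coordinates on `M(A){T}` with respect to the elements `e_i` and `τ e_i`. -/
def tateCoord (A : Matrix (Fin n) (Fin n) (CInfty F)) :
    TateModule F (TMotive A) ≃ₗ[(CInfty F)[X]] (Fin n ⊕ Fin n →₀ TateRing F) :=
  TensorProduct.equivFinsuppOfBasisLeft (motiveBasis A)

theorem tateCoord_tmul (A : Matrix (Fin n) (Fin n) (CInfty F)) (m : TMotive A) (f : TateRing F)
    (k : Fin n ⊕ Fin n) :
    tateCoord A (m ⊗ₜ[(CInfty F)[X]] f : TMotive A ⊗[(CInfty F)[X]] TateRing F) k =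
      (motiveBasis A).repr m k • f :=
  TensorProduct.equivFinsuppOfBasisLeft_apply_tmul_apply _ _ _ _

theorem tateTau_smul (f : (CInfty F)[X]) (g : TateRing F) :
    tateFrob F (f • g) = polyFrob F f • tateFrob F g :=
  LinearMap.map_smulₛₗ (tateTau F) f g

theorem tateCoord_tau_inl (A : Matrix (Fin n) (Fin n) (CInfty F))
    (x : TateModule F (TMotive A)) (i : Fin n) :
    tateCoord A (tateModuleTau F (TMotive A) x) (Sum.inl i) =
      (Polynomial.X - Polynomial.C (theta F)) • tateFrob F (tateCoord A x (Sum.inr i)) := by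
  refine TensorProduct.induction_on (motive := fun x : TMotive A ⊗[(CInfty F)[X]] TateRing F ↦
    tateCoord A (tateModuleTau F (TMotive A) x) (Sum.inl i) =
      (Polynomial.X - Polynomial.C (theta F)) • tateFrob F (tateCoord A x (Sum.inr i)))
    x ?_ ?_ ?_
  · have h0 : tateCoord A (0 : TMotive A ⊗[(CInfty F)[X]] TateRing F) = 0 :=
      map_zero (tateCoord A)
    have h1 : tateModuleTau F (TMotive A) (0 : TMotive A ⊗[(CInfty F)[X]] TateRing F) = 0 :=
      map_zero (tateModuleTau F (TMotive A))
    rw [h1, map_zero, h0]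
    simp
  · intro m f
    have h : tateModuleTau F (TMotive A) (m ⊗ₜ[(CInfty F)[X]] f) =
      (moduleTau F (TMotive A) m ⊗ₜ[(CInfty F)[X]] tateFrob F f) := rfl
    rw [h, tateCoord_tmul, tateCoord_tmul, tateTau_smul, motiveBasis_repr_inl, toCoord_tau,
      motiveBasis_repr_inr, smul_smul]
    rfl
  · intro x y hx hy
    have h0 : tateCoord A (x + y) = tateCoord A x + tateCoord A y := map_add (tateCoord A) x y
    have h1 : tateModuleTau F (TMotive A) (x + y) = tateModuleTau F (TMotive A) x +
      tateModuleTau F (TMotive A) y := map_add (tateModuleTau F (TMotive A)) x y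
    rw [h1, map_add, h0, Finsupp.add_apply, Finsupp.add_apply, map_add, smul_add, hx, hy]

theorem tateCoord_tau_inr (A : Matrix (Fin n) (Fin n) (CInfty F))
    (x : TateModule F (TMotive A)) (j : Fin n) :
    tateCoord A (tateModuleTau F (TMotive A) x) (Sum.inr j) =
      tateFrob F (tateCoord A x (Sum.inl j)) -
        ∑ i, Polynomial.C (A i j) • tateFrob F (tateCoord A x (Sum.inr i)) := by
  refine TensorProduct.induction_on (motive := fun x : TMotive A ⊗[(CInfty F)[X]] TateRing F ↦
    tateCoord A (tateModuleTau F (TMotive A) x) (Sum.inr j) =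
      tateFrob F (tateCoord A x (Sum.inl j)) -
        ∑ i, Polynomial.C (A i j) • tateFrob F (tateCoord A x (Sum.inr i)))
    x ?_ ?_ ?_
  · have h0 : tateCoord A (0 : TMotive A ⊗[(CInfty F)[X]] TateRing F) = 0 :=
      map_zero (tateCoord A)
    have h1 : tateModuleTau F (TMotive A) (0 : TMotive A ⊗[(CInfty F)[X]] TateRing F) = 0 :=
      map_zero (tateModuleTau F (TMotive A))
    rw [h1, map_zero, h0]
    simp
  · intro m f
    have h : tateModuleTau F (TMotive A) (m ⊗ₜ[(CInfty F)[X]] f) =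
      (moduleTau F (TMotive A) m ⊗ₜ[(CInfty F)[X]] tateFrob F f) := rfl
    simp only [h, tateCoord_tmul, tateTau_smul, motiveBasis_repr_inr, motiveBasis_repr_inl,
      toCoord_tau, smul_smul]
    rw [← Finset.sum_smul, ← sub_smul]
    rfl
  · intro x y hx hy
    have h0 : tateCoord A (x + y) = tateCoord A x + tateCoord A y := map_add (tateCoord A) x y
    have h1 : tateModuleTau F (TMotive A) (x + y) = tateModuleTau F (TMotive A) x +
      tateModuleTau F (TMotive A) y := map_add (tateModuleTau F (TMotive A)) x y
    rw [h1, map_add, h0, Finsupp.add_apply, hx, hy]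
    simp only [Finsupp.add_apply, map_add, smul_add, Finset.sum_add_distrib]
    abel

/-- The `k`-th coefficient of an element of `ℂ_∞{T}`. -/
def tateCoeff (k : ℕ) : TateRing F →+ CInfty F :=
  (PowerSeries.coeff (R := CInfty F) k).toAddMonoidHom.comp
    (PowerSeries.IsRestricted.subring (R := CInfty F) 1).subtype.toAddMonoidHom

theorem tateRing_ext {f g : TateRing F} (h : ∀ k, tateCoeff k f = tateCoeff k g) : f = g :=
  Subtype.ext (PowerSeries.ext h)

theorem tateCoeff_tateFrob (k : ℕ) (f : TateRing F) :
    tateCoeff k (tateFrob F f) = tateCoeff k f ^ Fintype.card F :=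
  PowerSeries.coeff_map (frob F) k f.1

theorem tateCoeff_C_smul (k : ℕ) (a : CInfty F) (f : TateRing F) :
    tateCoeff k (Polynomial.C a • f) = a * tateCoeff k f := by
  have h : tateCoeff k (Polynomial.C a • f) =
    PowerSeries.coeff k (((Polynomial.C a : (CInfty F)[X]) : PowerSeries (CInfty F)) * f.1) := rfl
  rw [h, Polynomial.coe_C, PowerSeries.coeff_C_mul]
  rfl

theorem tateCoeff_zero_X_smul (f : TateRing F) :
    tateCoeff 0 ((Polynomial.X : (CInfty F)[X]) • f) = 0 := by
  have h : tateCoeff 0 ((Polynomial.X : (CInfty F)[X]) • f) =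
    PowerSeries.coeff 0 (((Polynomial.X : (CInfty F)[X]) : PowerSeries (CInfty F)) * f.1) := rfl
  rw [h, Polynomial.coe_X, PowerSeries.coeff_zero_X_mul]

theorem tateCoeff_succ_X_smul (k : ℕ) (f : TateRing F) :
    tateCoeff (k + 1) ((Polynomial.X : (CInfty F)[X]) • f) = tateCoeff k f := by
  have h : tateCoeff (k + 1) ((Polynomial.X : (CInfty F)[X]) • f) =
    PowerSeries.coeff (k + 1)
      (((Polynomial.X : (CInfty F)[X]) : PowerSeries (CInfty F)) * f.1) := rfl
  rw [h, Polynomial.coe_X, PowerSeries.coeff_succ_X_mul]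
  rfl

open Filter Topology in
theorem tendsto_tateCoeff (f : TateRing F) : Tendsto (fun k ↦ tateCoeff k f) atTop (𝓝 0) := by
  have h := (PowerSeries.isRestricted_iff' 1 f.1).1 f.2
  simp only [one_pow, mul_one] at h
  exact tendsto_zero_iff_norm_tendsto_zero.2 h

open Filter Topology in
theorem exists_tateCoeff_eq (x : ℕ → CInfty F) (hx : Tendsto x atTop (𝓝 0)) :
    ∃ f : TateRing F, ∀ k, tateCoeff k f = x k := by
  refine ⟨⟨PowerSeries.mk x, (PowerSeries.isRestricted_iff' 1 _).2 ?_⟩, fun k ↦ ?_⟩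
  · simpa using tendsto_zero_iff_norm_tendsto_zero.1 hx
  · exact PowerSeries.coeff_mk k x

/-- The coefficients of `T ^ k` in the coordinates at the `τ e_i` of an element of `H¹(M(A))`. -/
def h1Coeff (A : Matrix (Fin n) (Fin n) (CInfty F)) (k : ℕ) :
    H1 F (TMotive A) →+ (Fin n → CInfty F) where
  toFun x i := tateCoeff k (tateCoord A x.1 (Sum.inr i))
  map_zero' := by ext i; simp
  map_add' x y := by ext i; simp

theorem h1Coeff_apply (A : Matrix (Fin n) (Fin n) (CInfty F)) (k : ℕ) (x : H1 F (TMotive A))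
    (i : Fin n) : h1Coeff A k x i = tateCoeff k (tateCoord A x.1 (Sum.inr i)) := rfl

theorem mem_H1_iff (A : Matrix (Fin n) (Fin n) (CInfty F)) (x : TateModule F (TMotive A)) :
    x ∈ H1 F (TMotive A) ↔
      (∀ i, tateCoord A x (Sum.inl i) =
        (Polynomial.X - Polynomial.C (theta F)) • tateFrob F (tateCoord A x (Sum.inr i))) ∧
      ∀ j, tateCoord A x (Sum.inr j) = tateFrob F (tateCoord A x (Sum.inl j)) -
        ∑ i, Polynomial.C (A i j) • tateFrob F (tateCoord A x (Sum.inr i)) := by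
  have h : x ∈ H1 F (TMotive A) ↔ tateModuleTau F (TMotive A) x = x := Iff.rfl
  rw [h, ← (tateCoord A).injective.eq_iff, Finsupp.ext_iff, Sum.forall]
  simp only [tateCoord_tau_inl, tateCoord_tau_inr]
  exact and_congr (forall_congr' fun i ↦ eq_comm) (forall_congr' fun i ↦ eq_comm)

end TateCoordinates

/-! ### `H¹` as the space of null solutions of a recursion -/

section Recursion

variable {F : Type*} [Field F] [Fintype F] {n : ℕ}

attribute [local instance] polyModule

open Filter Topology

theorem algebraMap_pow_card_pow (a : F) (k : ℕ) :
    algebraMap F (CInfty F) a ^ Fintype.card F ^ k = algebraMap F (CInfty F) a := by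
  rw [← map_pow, FiniteField.pow_card_pow]

theorem add_pow_card_pow (x y : CInfty F) (k : ℕ) :
    (x + y) ^ Fintype.card F ^ k = x ^ Fintype.card F ^ k + y ^ Fintype.card F ^ k := by
  induction k with
  | zero => simp
  | succ k ih =>
    rw [pow_succ, pow_mul, pow_mul, pow_mul, ih]
    exact map_add (frob F) _ _

theorem add_pow_card (x y : CInfty F) :
    (x + y) ^ Fintype.card F = x ^ Fintype.card F + y ^ Fintype.card F :=
  map_add (frob F) _ _

theorem norm_algebraMap_le_one (a : F) : ‖algebraMap F (CInfty F) a‖ ≤ 1 := by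
  by_contra! h
  have h1 := congrArg norm (algebraMap_pow_card_pow (F := F) a 1)
  rw [norm_pow, pow_one] at h1
  exact absurd h1 (lt_self_pow₀ h Fintype.one_lt_card).ne'

theorem norm_smul_le_norm (a : F) (x : CInfty F) : ‖a • x‖ ≤ ‖x‖ := by
  rw [Algebra.smul_def, norm_mul]
  exact mul_le_of_le_one_left (norm_nonneg _) (norm_algebraMap_le_one a)

/-- The additive operator `z ↦ z + θ^q z^(q²) + z^q A` that governs the coefficients of
`τ`-invariant elements. -/
def recOp (A : Matrix (Fin n) (Fin n) (CInfty F)) :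
    (Fin n → CInfty F) →ₗ[F] (Fin n → CInfty F) where
  toFun z j := z j + theta F ^ Fintype.card F * z j ^ Fintype.card F ^ 2 +
    ∑ i, A i j * z i ^ Fintype.card F
  map_add' x y := by
    funext j
    simp only [Pi.add_apply, add_pow_card, add_pow_card_pow, mul_add, Finset.sum_add_distrib]
    ring
  map_smul' a x := by
    funext j
    have h : algebraMap F (CInfty F) a ^ Fintype.card F = algebraMap F (CInfty F) a := by
      simpa using algebraMap_pow_card_pow (F := F) a 1
    simp only [Pi.smul_apply, Algebra.smul_def, RingHom.id_apply, mul_pow,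
      algebraMap_pow_card_pow, h, mul_add, Finset.mul_sum]
    congr 1
    · ring
    · exact Finset.sum_congr rfl fun i _ ↦ by ring

theorem recOp_apply (A : Matrix (Fin n) (Fin n) (CInfty F)) (z : Fin n → CInfty F) (j : Fin n) :
    recOp A z j = z j + theta F ^ Fintype.card F * z j ^ Fintype.card F ^ 2 +
      ∑ i, A i j * z i ^ Fintype.card F := rfl

theorem tateFrob_X_sub_smul (g : TateRing F) :
    tateFrob F ((Polynomial.X - Polynomial.C (theta F)) • tateFrob F g) =
      (Polynomial.X : (CInfty F)[X]) • tateFrob F (tateFrob F g) -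
        Polynomial.C (theta F ^ Fintype.card F) • tateFrob F (tateFrob F g) := by
  rw [tateTau_smul, map_sub, sub_smul]
  simp [polyFrob, frob_apply]

/-- Substituting the coordinates at the `e_i` into the equations at the `τ e_j` leaves a system of
second order in `τ` for the latter coordinates alone. Its terms without `T` form `recOp A`. -/
theorem mem_H1_iff_inr (A : Matrix (Fin n) (Fin n) (CInfty F)) (x : TateModule F (TMotive A)) :
    x ∈ H1 F (TMotive A) ↔
      (∀ i, tateCoord A x (Sum.inl i) =
        (Polynomial.X - Polynomial.C (theta F)) • tateFrob F (tateCoord A x (Sum.inr i))) ∧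
      ∀ j, tateCoord A x (Sum.inr j) +
        Polynomial.C (theta F ^ Fintype.card F) •
          tateFrob F (tateFrob F (tateCoord A x (Sum.inr j))) +
        ∑ i, Polynomial.C (A i j) • tateFrob F (tateCoord A x (Sum.inr i)) =
        (Polynomial.X : (CInfty F)[X]) • tateFrob F (tateFrob F (tateCoord A x (Sum.inr j))) := by
  rw [mem_H1_iff]
  refine and_congr_right fun h ↦ forall_congr' fun j ↦ ?_
  rw [h j, tateFrob_X_sub_smul, eq_sub_iff_add_eq, eq_sub_iff_add_eq, add_right_comm]

theorem recOp_h1Coeff_zero (A : Matrix (Fin n) (Fin n) (CInfty F)) (x : H1 F (TMotive A)) :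
    recOp A (h1Coeff A 0 x) = 0 := by
  funext j
  have h := congrArg (tateCoeff 0) (((mem_H1_iff_inr A x.1).1 x.2).2 j)
  simp only [map_add, map_sum, tateCoeff_C_smul, tateCoeff_tateFrob, tateCoeff_zero_X_smul,
    ← pow_mul, ← pow_two] at h
  exact h

theorem recOp_h1Coeff_succ (A : Matrix (Fin n) (Fin n) (CInfty F)) (x : H1 F (TMotive A))
    (k : ℕ) : recOp A (h1Coeff A (k + 1) x) = h1Coeff A k x ^ Fintype.card F ^ 2 := by
  funext j
  have h := congrArg (tateCoeff (k + 1)) (((mem_H1_iff_inr A x.1).1 x.2).2 j)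
  simp only [map_add, map_sum, tateCoeff_C_smul, tateCoeff_tateFrob, tateCoeff_succ_X_smul,
    ← pow_mul, ← pow_two] at h
  exact h

theorem tendsto_h1Coeff (A : Matrix (Fin n) (Fin n) (CInfty F)) (x : H1 F (TMotive A)) :
    Tendsto (fun k ↦ h1Coeff A k x) atTop (𝓝 0) :=
  tendsto_pi_nhds.2 fun _ ↦ tendsto_tateCoeff _

theorem eq_zero_of_h1Coeff (A : Matrix (Fin n) (Fin n) (CInfty F)) (x : H1 F (TMotive A))
    (h : ∀ k, h1Coeff A k x = 0) : x = 0 := by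
  have h2 : ∀ i, tateCoord A x.1 (Sum.inr i) = 0 := fun i ↦
    tateRing_ext fun k ↦ by
      rw [← h1Coeff_apply, h k, map_zero, Pi.zero_apply]
  have h1 : ∀ i, tateCoord A x.1 (Sum.inl i) = 0 := fun i ↦ by
    rw [((mem_H1_iff_inr A x.1).1 x.2).1 i, h2, map_zero, smul_zero]
  refine Subtype.ext ((tateCoord A).injective (Finsupp.ext ?_))
  rintro (i | i)
  · simp [h1]
  · simp [h2]

/-- Converse to the recursion for coefficients: `z` gives the coordinates at the `τ e_i`, and those
at the `e_i` are then forced. -/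
theorem exists_h1Coeff_eq (A : Matrix (Fin n) (Fin n) (CInfty F)) (z : ℕ → Fin n → CInfty F)
    (hz : Tendsto z atTop (𝓝 0)) (h0 : recOp A (z 0) = 0)
    (hS : ∀ k, recOp A (z (k + 1)) = z k ^ Fintype.card F ^ 2) :
    ∃ x : H1 F (TMotive A), ∀ k, h1Coeff A k x = z k := by
  choose g hg using fun i ↦ exists_tateCoeff_eq (fun k ↦ z k i) (tendsto_pi_nhds.1 hz i)
  let y : Fin n ⊕ Fin n →₀ TateRing F := Finsupp.equivFunOnFinite.symm
    (Sum.elim (fun i ↦ (Polynomial.X - Polynomial.C (theta F)) • tateFrob F (g i)) g)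
  have hy : tateCoord A ((tateCoord A).symm y) = y := (tateCoord A).apply_symm_apply y
  have hmem : (tateCoord A).symm y ∈ H1 F (TMotive A) := by
    rw [mem_H1_iff_inr, hy]
    refine ⟨fun i ↦ rfl, fun j ↦ tateRing_ext fun k ↦ ?_⟩
    change tateCoeff k (g j + _ • tateFrob F (tateFrob F (g j)) +
      ∑ i, Polynomial.C (A i j) • tateFrob F (g i)) =
      tateCoeff k ((Polynomial.X : (CInfty F)[X]) • tateFrob F (tateFrob F (g j)))
    rcases k with _ | k
    · have h := congrFun h0 j
      simp only [map_add, map_sum, tateCoeff_C_smul, tateCoeff_tateFrob, tateCoeff_zero_X_smul,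
        ← pow_mul, ← pow_two, hg]
      exact h
    · have h := congrFun (hS k) j
      simp only [map_add, map_sum, tateCoeff_C_smul, tateCoeff_tateFrob, tateCoeff_succ_X_smul,
        ← pow_mul, ← pow_two, hg]
      exact h
  refine ⟨⟨_, hmem⟩, fun k ↦ funext fun i ↦ ?_⟩
  rw [h1Coeff_apply, hy]
  exact hg i k

theorem tateCoord_smul (A : Matrix (Fin n) (Fin n) (CInfty F)) (p : F[X])
    (x : H1 F (TMotive A)) (i : Fin n ⊕ Fin n) :
    tateCoord A (p • x).1 i = p.map (algebraMap F (CInfty F)) • tateCoord A x.1 i := by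
  have h : (p • x).1 = p.map (algebraMap F (CInfty F)) • x.1 := rfl
  rw [h, map_smul, Finsupp.smul_apply]

theorem h1Coeff_C_smul (A : Matrix (Fin n) (Fin n) (CInfty F)) (k : ℕ) (a : F)
    (x : H1 F (TMotive A)) : h1Coeff A k (Polynomial.C a • x) = a • h1Coeff A k x := by
  funext i
  rw [h1Coeff_apply, tateCoord_smul, Polynomial.map_C, tateCoeff_C_smul, Pi.smul_apply,
    h1Coeff_apply, Algebra.smul_def]

theorem h1Coeff_zero_X_smul (A : Matrix (Fin n) (Fin n) (CInfty F))
    (x : H1 F (TMotive A)) : h1Coeff A 0 ((Polynomial.X : F[X]) • x) = 0 := by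
  funext i
  rw [h1Coeff_apply, tateCoord_smul, Polynomial.map_X, tateCoeff_zero_X_smul, Pi.zero_apply]

theorem h1Coeff_succ_X_smul (A : Matrix (Fin n) (Fin n) (CInfty F)) (k : ℕ)
    (x : H1 F (TMotive A)) :
    h1Coeff A (k + 1) ((Polynomial.X : F[X]) • x) = h1Coeff A k x := by
  funext i
  rw [h1Coeff_apply, tateCoord_smul, Polynomial.map_X, tateCoeff_succ_X_smul, h1Coeff_apply]

/-- The closed ball of radius `r` about `0` is an `F`-subspace. -/
def ballSubmodule (F : Type*) [Field F] [Fintype F] (n : ℕ) (r : ℝ) (hr : 0 ≤ r) :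
    Submodule F (Fin n → CInfty F) where
  carrier := {z | ∀ i, ‖z i‖ ≤ r}
  zero_mem' i := by simpa using hr
  add_mem' hx hy i := (IsUltrametricDist.norm_add_le_max _ _).trans (max_le (hx i) (hy i))
  smul_mem' a _ hx i := (norm_smul_le_norm a _).trans (hx i)

/-- The operator `recOp A` is injective on a small ball. -/
theorem exists_ball_recOp_injective (A : Matrix (Fin n) (Fin n) (CInfty F)) :
    ∃ r : ℝ, 0 < r ∧ ∀ z, recOp A z = 0 → (∀ i, ‖z i‖ ≤ r) → z = 0 := by
  set R : ℝ := 1 + ‖theta F‖ ^ Fintype.card F + ∑ j, ∑ i, ‖A i j‖ with hR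
  have hsum : 0 ≤ ∑ j, ∑ i, ‖A i j‖ := by positivity
  have hRpos : 0 < R := by positivity
  -- All non-linear terms have degree at least 2, so on this ball their sum is at most `R ‖z‖ (2R)⁻¹
  -- = ‖z‖ / 2`. They cannot cancel `z` unless `z = 0`.
  refine ⟨(2 * R)⁻¹, by positivity, fun z hz hsmall ↦ ?_⟩
  have hr1 : (2 * R)⁻¹ ≤ 1 := inv_le_one_of_one_le₀ (by
    have : 0 ≤ ‖theta F‖ ^ Fintype.card F := by positivity
    linarith)
  have hzr : ‖z‖ ≤ (2 * R)⁻¹ := (pi_norm_le_iff_of_nonneg (by positivity)).2 hsmall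
  have hpow : ∀ i, ∀ m, 2 ≤ m → ‖z i‖ ^ m ≤ ‖z‖ * (2 * R)⁻¹ := by
    intro i m hm
    calc ‖z i‖ ^ m ≤ ‖z‖ ^ m := by gcongr; exact norm_le_pi_norm z i
      _ ≤ ‖z‖ ^ 2 := pow_le_pow_of_le_one (norm_nonneg z) (hzr.trans hr1) hm
      _ = ‖z‖ * ‖z‖ := pow_two _
      _ ≤ ‖z‖ * (2 * R)⁻¹ := by gcongr
  have hq : 2 ≤ Fintype.card F := Fintype.one_lt_card
  have hhalf : ∀ j, ‖z j‖ ≤ ‖z‖ / 2 := by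
    intro j
    have h := congrFun hz j
    rw [recOp_apply, Pi.zero_apply, add_assoc, add_eq_zero_iff_eq_neg] at h
    have hAj : ∑ i, ‖A i j‖ ≤ ∑ j, ∑ i, ‖A i j‖ :=
      Finset.single_le_sum (f := fun j ↦ ∑ i, ‖A i j‖)
        (fun _ _ ↦ Finset.sum_nonneg fun _ _ ↦ norm_nonneg _) (Finset.mem_univ j)
    calc ‖z j‖ = ‖theta F ^ Fintype.card F * z j ^ Fintype.card F ^ 2 +
          ∑ i, A i j * z i ^ Fintype.card F‖ := by conv_lhs => rw [h, norm_neg]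
      _ ≤ ‖theta F‖ ^ Fintype.card F * ‖z j‖ ^ Fintype.card F ^ 2 +
          ∑ i, ‖A i j‖ * ‖z i‖ ^ Fintype.card F := by
        refine (norm_add_le _ _).trans (add_le_add ?_ ?_)
        · rw [norm_mul, norm_pow, norm_pow]
        · refine (norm_sum_le _ _).trans_eq (Finset.sum_congr rfl fun i _ ↦ ?_)
          rw [norm_mul, norm_pow]
      _ ≤ ‖theta F‖ ^ Fintype.card F * (‖z‖ * (2 * R)⁻¹) +
          ∑ i, ‖A i j‖ * (‖z‖ * (2 * R)⁻¹) := by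
        gcongr with i
        · exact hpow j _ (hq.trans (Nat.le_self_pow two_ne_zero _))
        · exact hpow i _ hq
      _ = (‖theta F‖ ^ Fintype.card F + ∑ i, ‖A i j‖) * (‖z‖ * (2 * R)⁻¹) := by
        rw [← Finset.sum_mul]; ring
      _ ≤ R * (‖z‖ * (2 * R)⁻¹) := by gcongr; linarith
      _ = ‖z‖ / 2 := by field_simp
  have h := (pi_norm_le_iff_of_nonneg (by positivity)).2 hhalf
  have h0 : ‖z‖ = 0 := le_antisymm (by linarith) (norm_nonneg z)
  exact norm_eq_zero.1 h0

/-- `h¹` is at most the dimension of the kernel of `recOp A`. -/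
theorem h1_le_finrank_ker (A : Matrix (Fin n) (Fin n) (CInfty F))
    [FiniteDimensional F (LinearMap.ker (recOp A))] :
    h1 F (TMotive A) ≤ Module.finrank F (LinearMap.ker (recOp A)) := by
  obtain ⟨r, hr, hinj⟩ := exists_ball_recOp_injective A
  refine rank_le_of_coeffHom (h1Coeff A) (h1Coeff_C_smul A) (h1Coeff_zero_X_smul A)
    (h1Coeff_succ_X_smul A) (eq_zero_of_h1Coeff A) _ (ballSubmodule F n r hr.le)
    (fun v hv hB ↦ hinj v hv hB) ?_ ?_
  -- At the first non-zero coefficient the right side of the recursion is a power of zero.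
  · rintro x (_ | k) h
    · exact recOp_h1Coeff_zero A x
    · rw [LinearMap.mem_ker, recOp_h1Coeff_succ, h k (Nat.lt_succ_self k), zero_pow]
      exact pow_ne_zero _ Fintype.card_ne_zero
  · intro x
    have h := (tendsto_pi_nhds.1 (tendsto_h1Coeff A x))
    have h2 : ∀ i, ∀ᶠ k in atTop, ‖h1Coeff A k x i‖ ≤ r := fun i ↦
      ((tendsto_zero_iff_norm_tendsto_zero.1 (h i)).eventually_lt_const hr).mono
        fun _ hk ↦ hk.le
    exact eventually_atTop.1 (eventually_all.2 h2)

/-- If every element of the kernel of `recOp A` is the constant term of a `τ`-invariant element,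
then `h¹` is at least its dimension. -/
theorem finrank_ker_le_h1 (A : Matrix (Fin n) (Fin n) (CInfty F))
    [FiniteDimensional F (LinearMap.ker (recOp A))]
    (hA : ∀ w, recOp A w = 0 → ∃ z : ℕ → Fin n → CInfty F, z 0 = w ∧
      Tendsto z atTop (𝓝 0) ∧ ∀ k, recOp A (z (k + 1)) = z k ^ Fintype.card F ^ 2) :
    Module.finrank F (LinearMap.ker (recOp A)) ≤ h1 F (TMotive A) := by
  let b := Module.finBasis F (LinearMap.ker (recOp A))
  have hex : ∀ j, ∃ x : H1 F (TMotive A), h1Coeff A 0 x = b j := by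
    intro j
    obtain ⟨z, hz0, hz, hS⟩ := hA (b j) (b j).2
    obtain ⟨x, hx⟩ := exists_h1Coeff_eq A z hz (by rw [hz0]; exact (b j).2) hS
    exact ⟨x, by rw [hx, hz0]⟩
  choose x hx using hex
  have hind : LinearIndependent F fun j ↦ h1Coeff A 0 (x j) := by
    simp only [hx]
    exact b.linearIndependent.map' (Submodule.subtype _) (Submodule.ker_subtype _)
  have := (linearIndependent_of_coeffHom_zero (h1Coeff A) (h1Coeff_C_smul A)
    (h1Coeff_zero_X_smul A) (h1Coeff_succ_X_smul A) x hind).cardinal_lift_le_rank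
  simpa [h1] using this

end Recursion

/-! ### Sequences defined by recursion and their convergence -/

section Sequences

open Filter Topology

theorem exists_seq_of_two_step {α : Type*} (R : α → α → α → Prop) (a₀ a₁ : α)
    (h : ∀ x y, ∃ z, R x y z) :
    ∃ u : ℕ → α, u 0 = a₀ ∧ u 1 = a₁ ∧ ∀ k, R (u k) (u (k + 1)) (u (k + 2)) := by
  choose f hf using h
  let p : ℕ → α × α := fun k ↦ Nat.rec (a₀, a₁) (fun _ p ↦ (p.2, f p.1 p.2)) k
  exact ⟨fun k ↦ (p k).1, rfl, rfl, fun k ↦ hf _ _⟩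

theorem exists_seq_of_step {α : Type*} (R : ℕ → α → α → Prop) (a₀ : α)
    (h : ∀ k x, ∃ z, R k x z) : ∃ u : ℕ → α, u 0 = a₀ ∧ ∀ k, R k (u k) (u (k + 1)) := by
  choose f hf using h
  exact ⟨fun k ↦ Nat.rec a₀ (fun k x ↦ f k x) k, rfl, fun k ↦ hf _ _⟩

theorem tendsto_zero_of_two_step_le {N : ℕ → ℝ} (hN : ∀ k, 0 ≤ N k) {K : ℝ} (hK : K < 1)
    (h : ∀ k, N (k + 2) ≤ K * max (N (k + 1)) (N k)) : Tendsto N atTop (𝓝 0) := by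
  -- The maximum keeps the ratio positive. A factor `L` gained over two steps amounts to `κ = √L`
  -- per step.
  set L := max K (1 / 2)
  have hL0 : 0 < L := lt_max_of_lt_right (by norm_num)
  have hL1 : L < 1 := max_lt hK (by norm_num)
  set κ := √L
  have hκ0 : 0 < κ := Real.sqrt_pos.2 hL0
  have hκ1 : κ < 1 := by
    rw [← Real.sqrt_one]; exact Real.sqrt_lt_sqrt hL0.le hL1
  have hκ2 : κ ^ 2 = L := Real.sq_sqrt hL0.le
  set M := max (N 0) (N 1 / κ)
  have hM : 0 ≤ M := le_max_of_le_left (hN 0)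
  have hb : ∀ k, N k ≤ M * κ ^ k ∧ N (k + 1) ≤ M * κ ^ (k + 1) := by
    intro k
    induction k with
    | zero =>
      refine ⟨by rw [pow_zero, mul_one]; exact le_max_left _ _, ?_⟩
      rw [zero_add, pow_one, ← div_le_iff₀ hκ0]
      exact le_max_right _ _
    | succ k ih =>
      refine ⟨ih.2, (h k).trans ?_⟩
      have h1 : max (N (k + 1)) (N k) ≤ M * κ ^ k := by
        refine max_le (ih.2.trans ?_) ih.1
        gcongr M * ?_
        exact pow_le_pow_of_le_one hκ0.le hκ1.le (Nat.le_succ k)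
      calc K * max (N (k + 1)) (N k) ≤ L * (M * κ ^ k) := by
            gcongr
            · exact le_max_of_le_right (hN k)
            · exact le_max_left _ _
        _ = M * κ ^ (k + 1 + 1) := by rw [← hκ2]; ring
  refine squeeze_zero hN (fun k ↦ (hb k).1) ?_
  simpa using (tendsto_pow_atTop_nhds_zero_of_lt_one hκ0.le hκ1).const_mul M

theorem tendsto_zero_of_step_le {N ε : ℕ → ℝ} (hN : ∀ k, 0 ≤ N k) {K : ℝ} (hK0 : 0 ≤ K)
    (hK : K < 1) (hε : Tendsto ε atTop (𝓝 0)) (h : ∀ k, N (k + 1) ≤ max (K * N k) (ε k)) :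
    Tendsto N atTop (𝓝 0) := by
  rw [Metric.tendsto_atTop]
  intro δ hδ
  obtain ⟨m, hm⟩ := eventually_atTop.1 (hε.eventually_lt_const (half_pos hδ))
  have hb : ∀ k, N (m + k) ≤ max (K ^ k * N m) (δ / 2) := by
    intro k
    induction k with
    | zero => simp
    | succ k ih =>
      refine (h (m + k)).trans (max_le ?_ (le_max_of_le_right (hm _ (Nat.le_add_right _ _)).le))
      refine (mul_le_mul_of_nonneg_left ih hK0).trans ?_
      rw [mul_max_of_nonneg _ _ hK0]
      refine max_le_max (by rw [pow_succ']; exact (mul_assoc _ _ _).ge) ?_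
      exact mul_le_of_le_one_left (half_pos hδ).le hK.le
  have hlim : Tendsto (fun k ↦ K ^ k * N m) atTop (𝓝 0) := by
    simpa using (tendsto_pow_atTop_nhds_zero_of_lt_one hK0 hK).mul_const (N m)
  obtain ⟨l, hl⟩ := eventually_atTop.1 (hlim.eventually_lt_const hδ)
  refine ⟨m + l, fun k hk ↦ ?_⟩
  obtain ⟨j, rfl⟩ := Nat.exists_eq_add_of_le ((Nat.le_add_right m l).trans hk)
  rw [Real.dist_eq, sub_zero, abs_of_nonneg (hN _)]
  exact (hb j).trans_lt (max_lt (hl j (by lia)) (half_lt_self hδ))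

end Sequences

/-! ### Elimination of one unknown and the size of the kernel -/

section Elimination

variable {F : Type*} [Field F] [Fintype F]

theorem card_cast_eq_zero : ((Fintype.card F : ℕ) : CInfty F) = 0 := by
  have h : ((Fintype.card F : ℕ) : F) = 0 := Nat.cast_card_eq_zero F
  have := congrArg (algebraMap F (CInfty F)) h
  rwa [map_natCast, map_zero] at this

theorem pow_card_injective : Function.Injective fun x : CInfty F ↦ x ^ Fintype.card F :=
  (frob F).injective

theorem recOp_offDiag (a b : CInfty F) (z : Fin 2 → CInfty F) :
    recOp !![0, a; b, 0] z =
      ![z 0 + theta F ^ Fintype.card F * z 0 ^ Fintype.card F ^ 2 + b * z 1 ^ Fintype.card F,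
        z 1 + theta F ^ Fintype.card F * z 1 ^ Fintype.card F ^ 2 + a * z 0 ^ Fintype.card F] := by
  funext j
  fin_cases j <;> simp [recOp_apply, Fin.sum_univ_two]

theorem recOp_offDiag_eq_iff (a b : CInfty F) (z w : Fin 2 → CInfty F) :
    recOp !![0, a; b, 0] z = w ↔
      z 0 + theta F ^ Fintype.card F * z 0 ^ Fintype.card F ^ 2 + b * z 1 ^ Fintype.card F = w 0 ∧
      z 1 + theta F ^ Fintype.card F * z 1 ^ Fintype.card F ^ 2 + a * z 0 ^ Fintype.card F
        = w 1 := by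
  rw [recOp_offDiag, funext_iff, Fin.forall_fin_two]
  rfl

/-- The quotient `a / a^(q²)`. -/
def elimC (a : CInfty F) : CInfty F := a / a ^ Fintype.card F ^ 2

/-- The coefficient of `y^(q²)` after the elimination of `x`. -/
def elimP (a b : CInfty F) : CInfty F :=
  theta F ^ Fintype.card F + theta F ^ Fintype.card F ^ 2 * elimC a - a * b ^ Fintype.card F

/-- The coefficient of `y^(q⁴)` after the elimination of `x`. -/
def elimR (a : CInfty F) : CInfty F :=
  theta F ^ Fintype.card F ^ 2 * theta F ^ Fintype.card F ^ 3 * elimC a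

theorem sub_pow_card_pow (x y : CInfty F) (k : ℕ) :
    (x - y) ^ Fintype.card F ^ k = x ^ Fintype.card F ^ k - y ^ Fintype.card F ^ k := by
  rw [eq_sub_iff_add_eq, ← add_pow_card_pow, sub_add_cancel]

/-- Solve the equation for `a x^q`, raise it to the power `q²`, and use `elimC a` to turn `a^(q²)`
into `a`. -/
theorem mul_pow_eq_elimC_mul {a x y s : CInfty F} (ha : a ≠ 0)
    (h : y + theta F ^ Fintype.card F * y ^ Fintype.card F ^ 2 + a * x ^ Fintype.card F = s) :
    a * (x ^ Fintype.card F) ^ Fintype.card F ^ 2 = elimC a * (s ^ Fintype.card F ^ 2 -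
      y ^ Fintype.card F ^ 2 - theta F ^ Fintype.card F ^ 3 * y ^ Fintype.card F ^ 4) := by
  have h1 : a * x ^ Fintype.card F = s - y - theta F ^ Fintype.card F * y ^ Fintype.card F ^ 2 := by
    linear_combination h
  have h3 := congrArg (fun u ↦ u ^ Fintype.card F ^ 2) h1
  simp only [mul_pow, sub_pow_card_pow] at h3
  rw [← pow_mul (theta F), ← pow_mul y] at h3
  have e1 : Fintype.card F * Fintype.card F ^ 2 = Fintype.card F ^ 3 := by ring
  have e2 : Fintype.card F ^ 2 * Fintype.card F ^ 2 = Fintype.card F ^ 4 := by ring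
  rw [e1, e2] at h3
  rw [elimC, ← h3]
  have : a ^ Fintype.card F ^ 2 ≠ 0 := pow_ne_zero _ ha
  field_simp

/-- Elimination of `x` from the two equations for `x` and `y`. -/
theorem elimination {a b x y r s : CInfty F} (ha : a ≠ 0)
    (h : y + theta F ^ Fintype.card F * y ^ Fintype.card F ^ 2 + a * x ^ Fintype.card F = s) :
    x + theta F ^ Fintype.card F * x ^ Fintype.card F ^ 2 + b * y ^ Fintype.card F = r ↔
      y + elimP a b * y ^ Fintype.card F ^ 2 + elimR a * y ^ Fintype.card F ^ 4 =
        s - a * r ^ Fintype.card F +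
          theta F ^ Fintype.card F ^ 2 * elimC a * s ^ Fintype.card F ^ 2 := by
  set q := Fintype.card F
  have h1 : a * x ^ q = s - y - theta F ^ q * y ^ q ^ 2 := by linear_combination h
  have h2 := mul_pow_eq_elimC_mul ha h
  -- Frobenius is injective, so nothing is lost by passing to `q`-th powers, where `x` occurs only
  -- through `x^q`. The other equation expresses `x^q` by `y`.
  have h4 : (x + theta F ^ q * x ^ q ^ 2 + b * y ^ q = r) ↔
      x ^ q + theta F ^ q ^ 2 * (x ^ q) ^ q ^ 2 + b ^ q * y ^ q ^ 2 = r ^ q := by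
    rw [← (pow_card_injective (F := F)).eq_iff]
    simp only [add_pow_card, mul_pow]
    rw [← pow_mul (theta F), ← pow_mul y, ← pow_two, ← pow_mul x, ← pow_mul x, mul_comm (q ^ 2) q]
  rw [h4, ← mul_right_inj' ha, elimP, elimR]
  constructor
  · intro h5
    linear_combination (-1 : CInfty F) * h5 + h1 + theta F ^ q ^ 2 * h2
  · intro h5
    linear_combination (-1 : CInfty F) * h5 + h1 + theta F ^ q ^ 2 * h2

theorem finrank_eq_four_of_ncard {V : Type*} [AddCommGroup V] [Module F V] (W : Submodule F V)
    (hfin : (W : Set V).Finite) (hcard : (W : Set V).ncard = Fintype.card F ^ 4) :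
    FiniteDimensional F W ∧ Module.finrank F W = 4 := by
  have : Finite W := hfin
  have hfd : FiniteDimensional F W := inferInstance
  refine ⟨hfd, ?_⟩
  have h1 := Module.natCard_eq_pow_finrank (K := F) (V := W)
  have h2 : Nat.card W = (W : Set V).ncard := Nat.card_coe_set_eq _
  rw [h2, hcard, Nat.card_eq_fintype_card] at h1
  exact (Nat.pow_right_injective Fintype.one_lt_card h1).symm

/-- Projection to `y` is a bijection onto the roots of a separable polynomial of degree `q⁴`: as `a
≠ 0`, the second equation determines `x^q`, hence `x`. -/
theorem ncard_ker_of_ne_zero {a : CInfty F} (ha : a ≠ 0) (b : CInfty F) :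
    (LinearMap.ker (recOp !![0, a; b, 0]) : Set (Fin 2 → CInfty F)).Finite ∧
    (LinearMap.ker (recOp !![0, a; b, 0]) : Set (Fin 2 → CInfty F)).ncard =
      Fintype.card F ^ 4 := by
  set q := Fintype.card F
  have hq : 1 < q := Fintype.one_lt_card
  have hθ : theta F ≠ 0 := by rw [← norm_ne_zero_iff, norm_theta]; positivity
  have hq0 : ∀ k, k ≠ 0 → ((q ^ k : ℕ) : CInfty F) = 0 := fun k hk ↦ by
    rw [Nat.cast_pow, card_cast_eq_zero, zero_pow hk]
  have hR : elimR a ≠ 0 := by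
    rw [elimR, elimC]
    have : a ^ Fintype.card F ^ 2 ≠ 0 := pow_ne_zero _ ha
    positivity
  obtain ⟨hfin, hcard⟩ := ncard_trinomial_eq_zero (elimP a b) (elimR a)
    (Nat.one_lt_pow two_ne_zero hq) (Nat.pow_lt_pow_right hq (by norm_num : 2 < 4))
    (hq0 2 (by norm_num)) (hq0 4 (by norm_num)) hR
  have himage : (fun z : Fin 2 → CInfty F ↦ z 1) ''
      (LinearMap.ker (recOp !![0, a; b, 0]) : Set (Fin 2 → CInfty F)) =
      {y | y + elimP a b * y ^ q ^ 2 + elimR a * y ^ q ^ 4 = 0} := by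
    ext y
    constructor
    · rintro ⟨z, hz, rfl⟩
      obtain ⟨h0, h1⟩ := (recOp_offDiag_eq_iff a b z 0).1 hz
      have := (elimination ha h1).1 h0
      simpa using this
    · intro hy
      obtain ⟨x, hx⟩ := IsAlgClosed.exists_pow_nat_eq
        (-(y + theta F ^ q * y ^ q ^ 2) / a) (zero_lt_one.trans hq)
      have h1 : y + theta F ^ q * y ^ q ^ 2 + a * x ^ q = 0 := by
        rw [hx]; field_simp; ring
      refine ⟨![x, y], (recOp_offDiag_eq_iff a b _ 0).2 ⟨?_, h1⟩, rfl⟩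
      refine (elimination ha h1).2 ?_
      simpa using hy
  have hinj : Set.InjOn (fun z : Fin 2 → CInfty F ↦ z 1)
      (LinearMap.ker (recOp !![0, a; b, 0]) : Set (Fin 2 → CInfty F)) := by
    intro z hz w hw hzw
    have h1 := ((recOp_offDiag_eq_iff a b z 0).1 hz).2
    have h2 := ((recOp_offDiag_eq_iff a b w 0).1 hw).2
    have hzw' : z 1 = w 1 := hzw
    rw [hzw'] at h1
    have h3 : a * z 0 ^ q = a * w 0 ^ q := by linear_combination h1 - h2
    have h4 := pow_card_injective (mul_left_cancel₀ ha h3)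
    funext i
    fin_cases i
    · exact h4
    · exact hzw
  refine ⟨Set.Finite.of_finite_image (himage ▸ hfin) hinj, ?_⟩
  rw [← hinj.ncard_image, himage, hcard]

/-- The second equation has `q²` solutions `y`. Over each of them the `x` form a coset `ξ y + Y` of
the same group `Y` of order `q²`. -/
theorem ncard_ker_of_eq_zero (b : CInfty F) :
    (LinearMap.ker (recOp !![0, 0; b, 0]) : Set (Fin 2 → CInfty F)).Finite ∧
    (LinearMap.ker (recOp !![0, 0; b, 0]) : Set (Fin 2 → CInfty F)).ncard =
      Fintype.card F ^ 4 := by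
  set q := Fintype.card F
  have hq : 1 < q := Fintype.one_lt_card
  have hq2 : q < q ^ 2 := by nlinarith
  have hθ : theta F ≠ 0 := by rw [← norm_ne_zero_iff, norm_theta]; positivity
  obtain ⟨hfin, hcard⟩ := ncard_trinomial_eq_zero 0 (theta F ^ q) hq hq2 card_cast_eq_zero
    (by rw [Nat.cast_pow, card_cast_eq_zero, zero_pow two_ne_zero]) (pow_ne_zero _ hθ)
  set Y := {y : CInfty F | y + 0 * y ^ q + theta F ^ q * y ^ q ^ 2 = 0}
  have hex : ∀ y : CInfty F, ∃ x, x + theta F ^ q * x ^ q ^ 2 = - (b * y ^ q) := by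
    intro y
    obtain ⟨x, hx, -⟩ := exists_trinomial_eq 0 (theta F ^ q) (-(b * y ^ q)) hq hq2
    exact ⟨x, by linear_combination hx⟩
  choose ξ hξ using hex
  have hset : (LinearMap.ker (recOp !![0, 0; b, 0]) : Set (Fin 2 → CInfty F)) =
      (fun p : CInfty F × CInfty F ↦ ![p.1 + ξ p.2, p.2]) '' (Y ×ˢ Y) := by
    ext z
    refine (recOp_offDiag_eq_iff 0 b z 0).trans ⟨?_, ?_⟩
    · rintro ⟨h0, h1⟩
      refine ⟨(z 0 - ξ (z 1), z 1), ⟨?_, ?_⟩, ?_⟩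
      · change (z 0 - ξ (z 1)) + 0 * _ + theta F ^ q * (z 0 - ξ (z 1)) ^ q ^ 2 = 0
        rw [sub_pow_card_pow]
        rw [Pi.zero_apply] at h0
        linear_combination h0 - hξ (z 1)
      · change z 1 + 0 * _ + theta F ^ q * z 1 ^ q ^ 2 = 0
        rw [Pi.zero_apply] at h1
        linear_combination h1
      · funext i
        fin_cases i <;> simp
    · rintro ⟨⟨x, y⟩, ⟨hx, hy⟩, rfl⟩
      change x + 0 * x ^ q + theta F ^ q * x ^ q ^ 2 = 0 at hx
      change y + 0 * y ^ q + theta F ^ q * y ^ q ^ 2 = 0 at hy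
      refine ⟨?_, ?_⟩
      · change (x + ξ y) + theta F ^ q * (x + ξ y) ^ q ^ 2 + b * y ^ q = 0
        rw [add_pow_card_pow]
        linear_combination hx + hξ y
      · change y + theta F ^ q * y ^ q ^ 2 + 0 * (x + ξ y) ^ q = 0
        linear_combination hy
  have hinj : Function.Injective (fun p : CInfty F × CInfty F ↦ ![p.1 + ξ p.2, p.2]) := by
    rintro ⟨x, y⟩ ⟨x', y'⟩ h
    have h1 : y = y' := congrFun h 1
    have h0 : x + ξ y = x' + ξ y' := congrFun h 0
    subst h1
    rw [add_left_inj] at h0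
    rw [h0]
  rw [hset]
  refine ⟨(hfin.prod hfin).image _, ?_⟩
  rw [Set.ncard_image_of_injective _ hinj, Set.ncard_prod, hcard]
  ring

theorem finrank_ker_recOp_offDiag (a b : CInfty F) :
    FiniteDimensional F (LinearMap.ker (recOp !![0, a; b, 0])) ∧
    Module.finrank F (LinearMap.ker (recOp !![0, a; b, 0])) = 4 := by
  by_cases ha : a = 0
  · subst ha
    exact finrank_eq_four_of_ncard _ (ncard_ker_of_eq_zero b).1 (ncard_ker_of_eq_zero b).2
  · exact finrank_eq_four_of_ncard _ (ncard_ker_of_ne_zero ha b).1 (ncard_ker_of_ne_zero ha b).2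

end Elimination

/-! ### Null chains below the critical size -/

section Chains

open Filter Topology

variable {F : Type*} [Field F] [Fintype F]

theorem one_lt_norm_theta : 1 < ‖theta F‖ := by
  rw [norm_theta]; exact_mod_cast Fintype.one_lt_card

/-- Choosing a smallest root each time, both terms on the left are bounded by the right side. Since
`|x_k^(q²)|` is smaller than `|θ^q x_k^(q²)|` by the fixed factor `|θ|^(-q)`, the largest term
contracts up to the error `e k`. -/
theorem exists_chain_one (w : CInfty F) (e : ℕ → CInfty F) (he : Tendsto e atTop (𝓝 0)) :
    ∃ x : ℕ → CInfty F, x 0 = w ∧ Tendsto x atTop (𝓝 0) ∧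
      ∀ k, x (k + 1) + theta F ^ Fintype.card F * x (k + 1) ^ Fintype.card F ^ 2 =
        x k ^ Fintype.card F ^ 2 + e k := by
  set q := Fintype.card F
  have hq : 1 < q := Fintype.one_lt_card
  have hq2 : q < q ^ 2 := by nlinarith
  have hθ : 1 < ‖theta F‖ ^ q := one_lt_pow₀ one_lt_norm_theta (by lia)
  obtain ⟨x, hx0, hx⟩ := exists_seq_of_step
    (fun k x x' ↦ x' + 0 * x' ^ q + theta F ^ q * x' ^ q ^ 2 = x ^ q ^ 2 + e k ∧
      ‖x'‖ ≤ ‖x ^ q ^ 2 + e k‖ ∧ ‖(0 : CInfty F)‖ * ‖x'‖ ^ q ≤ ‖x ^ q ^ 2 + e k‖ ∧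
      ‖theta F ^ q‖ * ‖x'‖ ^ q ^ 2 ≤ ‖x ^ q ^ 2 + e k‖) w
    (fun k x ↦ exists_trinomial_eq 0 (theta F ^ q) (x ^ q ^ 2 + e k) hq hq2)
  refine ⟨x, hx0, ?_, fun k ↦ by linear_combination (hx k).1⟩
  set N : ℕ → ℝ := fun k ↦ max ‖x k‖ (‖theta F‖ ^ q * ‖x k‖ ^ q ^ 2) with hN
  have hN0 : ∀ k, 0 ≤ N k := fun k ↦ le_max_of_le_left (norm_nonneg _)
  have hstep : ∀ k, N (k + 1) ≤ max ((‖theta F‖ ^ q)⁻¹ * N k) ‖e k‖ := by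
    intro k
    obtain ⟨-, h1, -, h2⟩ := hx k
    rw [norm_pow] at h2
    refine (max_le h1 h2).trans ((IsUltrametricDist.norm_add_le_max _ _).trans
      (max_le_max ?_ le_rfl))
    rw [norm_pow, ← div_eq_inv_mul, le_div_iff₀ (by positivity), mul_comm]
    exact le_max_right _ _
  have hlim := tendsto_zero_of_step_le hN0 (by positivity) (inv_lt_one_of_one_lt₀ hθ)
    (tendsto_zero_iff_norm_tendsto_zero.1 he) hstep
  exact tendsto_zero_iff_norm_tendsto_zero.2
    (squeeze_zero (fun _ ↦ norm_nonneg _) (fun k ↦ le_max_left _ _) hlim)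

/-- The second component satisfies an equation of its own, and then enters the first one as an error
tending to zero. -/
theorem exists_chain_of_eq_zero (b : CInfty F) (w : Fin 2 → CInfty F) :
    ∃ z : ℕ → Fin 2 → CInfty F, z 0 = w ∧ Tendsto z atTop (𝓝 0) ∧
      ∀ k, recOp !![0, 0; b, 0] (z (k + 1)) = z k ^ Fintype.card F ^ 2 := by
  obtain ⟨y, hy0, hylim, hy⟩ := exists_chain_one (w 1) (fun _ ↦ 0) tendsto_const_nhds
  have he : Tendsto (fun k ↦ -(b * y (k + 1) ^ Fintype.card F)) atTop (𝓝 0) := by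
    have := (((hylim.comp (tendsto_add_atTop_nat 1)).pow (Fintype.card F)).const_mul b).neg
    simpa [zero_pow Fintype.card_ne_zero] using this
  obtain ⟨x, hx0, hxlim, hx⟩ := exists_chain_one (w 0) _ he
  refine ⟨fun k ↦ ![x k, y k], ?_, ?_, fun k ↦ (recOp_offDiag_eq_iff _ _ _ _).2 ⟨?_, ?_⟩⟩
  · funext i
    fin_cases i
    · exact hx0
    · exact hy0
  · refine tendsto_pi_nhds.2 fun i ↦ ?_
    fin_cases i
    · exact hxlim
    · exact hylim
  · change x (k + 1) + _ * x (k + 1) ^ _ + b * y (k + 1) ^ _ = x k ^ _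
    linear_combination hx k
  · change y (k + 1) + _ * y (k + 1) ^ _ + 0 * x (k + 1) ^ _ = y k ^ _
    linear_combination hy k

/-- The size of the largest term of `y + P y^(q²) + R y^(q⁴)`. -/
def termSize (a b y : CInfty F) : ℝ :=
  max ‖y‖ (max (‖elimP a b‖ * ‖y‖ ^ Fintype.card F ^ 2) (‖elimR a‖ * ‖y‖ ^ Fintype.card F ^ 4))

/-- Under the bounds on `a` and `b`, the coefficient `1 + a / a^(q²)` is dominated by one of the
other coefficients of the eliminated recursion. -/
theorem norm_one_add_elimC_lt {a b : CInfty F} (ha0 : a ≠ 0)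
    (ha : ‖a‖ ^ (Fintype.card F - 1) < ‖theta F‖ ^ Fintype.card F ^ 2)
    (hb : ‖b‖ ^ (Fintype.card F - 1) < ‖theta F‖ ^ Fintype.card F ^ 2) :
    ‖1 + elimC a‖ < ‖elimP a b‖ ∨
      ‖1 + elimC a‖ ^ (Fintype.card F ^ 2 + 1) < ‖elimR a‖ := by
  have hΘ := one_lt_norm_theta (F := F)
  obtain ⟨d, hd⟩ : ∃ d, Fintype.card F = d + 1 := ⟨Fintype.card F - 1, by
    have : 1 < Fintype.card F := Fintype.one_lt_card
    lia⟩
  have hd0 : 0 < d := by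
    have : 1 < Fintype.card F := Fintype.one_lt_card
    lia
  set Θ := ‖theta F‖
  set h := ‖a‖ with hh
  set g := ‖b‖
  set q := Fintype.card F
  rw [show q - 1 = d by lia] at ha hb
  have hhpos : 0 < h := norm_pos_iff.2 ha0
  have hC : ‖elimC a‖ = h / h ^ q ^ 2 := by rw [elimC, norm_div, norm_pow]
  have hR : ‖elimR a‖ = Θ ^ q ^ 2 * Θ ^ q ^ 3 * (h / h ^ q ^ 2) := by
    rw [elimR, norm_mul, norm_mul, norm_pow, norm_pow, hC]
  have hexp : h ^ q ^ 2 = h * (h ^ d) ^ (q + 1) := by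
    rw [← pow_mul, ← pow_succ']
    congr 1
    rw [hd]; ring
  rcases le_or_gt 1 h with h1 | h1
  -- For `|a| ≥ 1` one has `|1 + C| ≤ 1`, and the bound on `a` says exactly that `|R| > 1`.
  · right
    have hE : ‖1 + elimC a‖ ≤ 1 := by
      refine (IsUltrametricDist.norm_add_le_max _ _).trans (max_le norm_one.le ?_)
      rw [hC]
      refine div_le_one_of_le₀ ?_ (by positivity)
      exact le_self_pow₀ h1 (by positivity)
    refine (pow_le_one₀ (norm_nonneg _) hE).trans_lt ?_
    rw [hR, hexp, ← mul_div_assoc, lt_div_iff₀ (by positivity), one_mul, mul_comm]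
    gcongr
    calc (h ^ d) ^ (q + 1) < (Θ ^ q ^ 2) ^ (q + 1) := by gcongr
      _ = Θ ^ q ^ 2 * Θ ^ q ^ 3 := by rw [← pow_mul, ← pow_add]; congr 1; ring
  · by_contra! hcon
    obtain ⟨hcon1, hcon2⟩ := hcon
    set C := ‖elimC a‖
    have hC1 : C = ((h ^ d) ^ (q + 1))⁻¹ := by
      rw [hC, hexp]; field_simp
    have hhd : h ^ d < 1 := pow_lt_one₀ hhpos.le h1 hd0.ne'
    have hC2 : 1 < C := by
      rw [hC1]
      exact (one_lt_inv₀ (by positivity)).2 (pow_lt_one₀ (by positivity) hhd (by lia))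
    have hE : ‖1 + elimC a‖ = C := by
      rw [IsUltrametricDist.norm_add_eq_max_of_norm_ne_norm (by rw [norm_one]; exact hC2.ne),
        norm_one, max_eq_right hC2.le]
    rw [hE] at hcon1 hcon2
    have hq2 : q < q ^ 2 := by nlinarith
    have hmain : ‖theta F ^ q ^ 2 * elimC a‖ = Θ ^ q ^ 2 * C := by rw [norm_mul, norm_pow]
    have hlt : ‖theta F ^ q‖ < ‖theta F ^ q ^ 2 * elimC a‖ := by
      rw [hmain, norm_pow]
      calc Θ ^ q < Θ ^ q ^ 2 := pow_lt_pow_right₀ hΘ hq2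
        _ ≤ Θ ^ q ^ 2 * C := le_mul_of_one_le_right (by positivity) hC2.le
    have hsum : ‖theta F ^ q + theta F ^ q ^ 2 * elimC a‖ = Θ ^ q ^ 2 * C := by
      rw [IsUltrametricDist.norm_add_eq_max_of_norm_ne_norm hlt.ne, max_eq_right hlt.le, hmain]
    -- For `|a| < 1` the term `θ^(q²) C` dominates `θ^q` in `P`, and by itself exceeds `|1 + C| =
    -- |C|`. So `P` can fail to dominate only if `a b^q` has the same norm.
    have hab : h * g ^ q = Θ ^ q ^ 2 * C := by
      by_contra hne
      have hne' : ‖theta F ^ q + theta F ^ q ^ 2 * elimC a‖ ≠ ‖-(a * b ^ q)‖ := by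
        rw [hsum, norm_neg, norm_mul, norm_pow]; exact fun h ↦ hne h.symm
      have := IsUltrametricDist.norm_add_eq_max_of_norm_ne_norm hne'
      rw [← sub_eq_add_neg] at this
      have h2 : Θ ^ q ^ 2 * C ≤ ‖elimP a b‖ := by
        rw [elimP, this, ← hsum]; exact le_max_left _ _
      have h3 : C < Θ ^ q ^ 2 * C :=
        lt_mul_of_one_lt_left (by positivity) (one_lt_pow₀ hΘ (by positivity))
      linarith
    have hgh : g * h ^ q = Θ ^ q := by
      refine (pow_left_inj₀ (by positivity) (by positivity) (by positivity : q ≠ 0)).1 ?_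
      rw [mul_pow, ← pow_mul, ← pow_mul, ← pow_two]
      refine mul_left_cancel₀ hhpos.ne' ?_
      calc h * (g ^ q * h ^ q ^ 2) = (h * g ^ q) * h ^ q ^ 2 := by ring
        _ = h * Θ ^ q ^ 2 := by rw [hab, hC]; field_simp
    -- The equality `|b| |a|^q = |θ|^q` and the bound on `b` prevent `a` from being too small. This
    -- bounds `C` and lets `R` dominate.
    have hΘh : 1 < Θ * h ^ d := by
      refine (one_lt_pow_iff_of_nonneg (by positivity) (by positivity : q ≠ 0)).1 ?_
      have h2 : Θ ^ (q * d) < Θ ^ (q * d) * (Θ * h ^ d) ^ q := by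
        calc Θ ^ (q * d) = g ^ d * (h ^ q) ^ d := by rw [pow_mul, ← hgh, mul_pow]
          _ < Θ ^ q ^ 2 * (h ^ q) ^ d := by gcongr
          _ = Θ ^ (q * d) * (Θ * h ^ d) ^ q := by
            rw [mul_pow, ← mul_assoc, ← pow_add, ← pow_mul, ← pow_mul, mul_comm q d]
            congr 2
            rw [hd]; ring
      exact (lt_mul_iff_one_lt_right (by positivity)).1 h2
    have hCΘ : C < Θ ^ (q + 1) := by
      have h2 : 1 < (Θ * h ^ d) ^ (q + 1) := one_lt_pow₀ hΘh (Nat.succ_ne_zero q)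
      rw [mul_pow] at h2
      rw [hC1, inv_eq_one_div, div_lt_iff₀ (by positivity)]
      exact h2
    have : C ^ (q ^ 2 + 1) < ‖elimR a‖ := by
      rw [hR, ← hC, pow_succ]
      gcongr
      calc C ^ q ^ 2 < (Θ ^ (q + 1)) ^ q ^ 2 := by gcongr
        _ = Θ ^ q ^ 2 * Θ ^ q ^ 3 := by rw [← pow_mul, ← pow_add]; congr 1; ring
    linarith

/-- The expression on the left is the right side of the recursion for `y` after elimination, with
`y` the previous term and `y'` the one before it. -/
theorem exists_recursion_contraction {a b : CInfty F} (ha0 : a ≠ 0)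
    (ha : ‖a‖ ^ (Fintype.card F - 1) < ‖theta F‖ ^ Fintype.card F ^ 2)
    (hb : ‖b‖ ^ (Fintype.card F - 1) < ‖theta F‖ ^ Fintype.card F ^ 2) :
    ∃ K : ℝ, K < 1 ∧ ∀ y y' : CInfty F,
      ‖(1 + elimC a) * y ^ Fintype.card F ^ 2 +
        elimC a * (theta F ^ Fintype.card F ^ 2 + theta F ^ Fintype.card F ^ 3) *
          y ^ Fintype.card F ^ 4 - elimC a * y' ^ Fintype.card F ^ 4‖ ≤
      K * max (termSize a b y) (termSize a b y') := by
  have hΘ := one_lt_norm_theta (F := F)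
  set Θ := ‖theta F‖
  set q := Fintype.card F
  have hq : 1 < q := Fintype.one_lt_card
  have hsize0 : ∀ y, 0 ≤ termSize a b y := fun y ↦ le_max_of_le_left (norm_nonneg y)
  have hCpos : 0 < ‖elimC a‖ := by
    rw [elimC, norm_pos_iff]; exact div_ne_zero ha0 (pow_ne_zero _ ha0)
  have hR : ‖elimR a‖ = Θ ^ q ^ 2 * Θ ^ q ^ 3 * ‖elimC a‖ := by
    rw [elimR, norm_mul, norm_mul, norm_pow, norm_pow]
  have hRpos : 0 < ‖elimR a‖ := by rw [hR]; positivity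
  have hlin : ∃ K : ℝ, K < 1 ∧ ∀ y : CInfty F,
      ‖1 + elimC a‖ * ‖y‖ ^ q ^ 2 ≤ K * termSize a b y := by
    rcases norm_one_add_elimC_lt ha0 ha hb with h | h
    · have hPpos : 0 < ‖elimP a b‖ := (norm_nonneg _).trans_lt h
      refine ⟨‖1 + elimC a‖ / ‖elimP a b‖, (div_lt_one hPpos).2 h, fun y ↦ ?_⟩
      rw [div_mul_eq_mul_div, le_div_iff₀ hPpos, mul_assoc, mul_comm (‖y‖ ^ q ^ 2)]
      gcongr
      exact le_max_of_le_right (le_max_left _ _)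
    -- Interpolation: as `q² (q² + 1) = q² + q⁴`, the `(q² + 1)`-th power of `E |y|^(q²)` is `E^m /
    -- |R|` times the product of `|y|^(q²)` and `|R| |y|^(q⁴)`, which is at most `termSize^(q² +
    -- 1)`.
    · set E := ‖1 + elimC a‖
      have hE0 : 0 ≤ E := norm_nonneg _
      set m := q ^ 2 + 1
      have hratio : E ^ m / ‖elimR a‖ < 1 := (div_lt_one hRpos).2 h
      set K := (E ^ m / ‖elimR a‖) ^ ((m : ℝ)⁻¹)
      have hK0 : 0 ≤ K := by positivity
      have hKm : K ^ m = E ^ m / ‖elimR a‖ :=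
        Real.rpow_inv_natCast_pow (by positivity) (Nat.succ_ne_zero _)
      refine ⟨K, Real.rpow_lt_one (by positivity) hratio (by positivity), fun y ↦ ?_⟩
      refine (pow_le_pow_iff_left₀ (by positivity) (mul_nonneg hK0 (hsize0 y))
        (Nat.succ_ne_zero (q ^ 2))).1 ?_
      change (E * ‖y‖ ^ q ^ 2) ^ m ≤ (K * termSize a b y) ^ m
      have h1 : ‖y‖ ≤ termSize a b y := le_max_left _ _
      have h2 : ‖elimR a‖ * ‖y‖ ^ q ^ 4 ≤ termSize a b y :=
        le_max_of_le_right (le_max_right _ _)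
      calc (E * ‖y‖ ^ q ^ 2) ^ m = E ^ m / ‖elimR a‖ *
            (‖y‖ ^ q ^ 2 * (‖elimR a‖ * ‖y‖ ^ q ^ 4)) := by
            have e : (‖y‖ ^ q ^ 2) ^ m = ‖y‖ ^ q ^ 2 * ‖y‖ ^ q ^ 4 := by
              rw [← pow_mul, ← pow_add]; congr 1; simp only [m]; ring
            rw [mul_pow, e]
            field_simp
        _ ≤ E ^ m / ‖elimR a‖ * (termSize a b y ^ q ^ 2 * termSize a b y) := by
            gcongr
            exact pow_nonneg (hsize0 y) _
        _ = (K * termSize a b y) ^ m := by rw [mul_pow, hKm, ← pow_succ]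
  obtain ⟨K, hK, hle⟩ := hlin
  refine ⟨max K Θ⁻¹, max_lt hK (inv_lt_one_of_one_lt₀ hΘ), fun y y' ↦ ?_⟩
  set B := max (termSize a b y) (termSize a b y')
  have hB0 : 0 ≤ B := le_max_of_le_left (hsize0 y)
  have hL0 : 0 ≤ max K Θ⁻¹ := le_max_of_le_right (by positivity)
  -- The coefficients of the `q⁴`-th powers are smaller than `R = θ^(q² + q³) C` by at least a
  -- factor `|θ|`.
  have hquart : ∀ (c u : CInfty F), ‖c‖ * Θ ≤ ‖elimR a‖ → termSize a b u ≤ B →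
      ‖c * u ^ q ^ 4‖ ≤ max K Θ⁻¹ * B := by
    intro c u hc hu
    rw [norm_mul, norm_pow]
    calc ‖c‖ * ‖u‖ ^ q ^ 4 ≤ ‖elimR a‖ / Θ * ‖u‖ ^ q ^ 4 := by
          gcongr; rwa [le_div_iff₀ (by positivity)]
      _ = Θ⁻¹ * (‖elimR a‖ * ‖u‖ ^ q ^ 4) := by ring
      _ ≤ max K Θ⁻¹ * B := by
          gcongr
          · exact le_max_right _ _
          · exact (le_max_of_le_right (le_max_right _ _)).trans hu
  have hq2 : Θ ≤ Θ ^ q ^ 2 := le_self_pow₀ hΘ.le (by positivity)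
  have hq3 : 1 ≤ Θ ^ q ^ 3 := one_le_pow₀ hΘ.le
  rw [sub_eq_add_neg]
  refine (IsUltrametricDist.norm_add_le_max _ _).trans (max_le
    ((IsUltrametricDist.norm_add_le_max _ _).trans (max_le ?_ ?_)) ?_)
  · rw [norm_mul, norm_pow]
    refine (hle y).trans (mul_le_mul (le_max_left _ _) (le_max_left _ _) (hsize0 y) hL0)
  · refine hquart _ _ ?_ (le_max_left _ _)
    have h1 : ‖theta F ^ q ^ 2 + theta F ^ q ^ 3‖ ≤ Θ ^ q ^ 3 := by
      refine (IsUltrametricDist.norm_add_le_max _ _).trans (max_le ?_ (norm_pow _ _).le)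
      rw [norm_pow]
      exact pow_le_pow_right₀ hΘ.le (Nat.pow_le_pow_right (by lia) (by norm_num))
    rw [norm_mul, hR]
    calc ‖elimC a‖ * ‖theta F ^ q ^ 2 + theta F ^ q ^ 3‖ * Θ ≤
          ‖elimC a‖ * Θ ^ q ^ 3 * Θ ^ q ^ 2 := by gcongr
      _ = _ := by ring
  · rw [norm_neg]
    refine hquart _ _ ?_ (le_max_right _ _)
    rw [hR]
    calc ‖elimC a‖ * Θ ≤ ‖elimC a‖ * (Θ ^ q ^ 2 * Θ ^ q ^ 3) := by
          gcongr; exact hq2.trans (le_mul_of_one_le_right (by positivity) hq3)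
      _ = _ := by ring

theorem tendsto_zero_of_pow {x : ℕ → CInfty F} {m : ℕ}
    (h : Tendsto (fun k ↦ x k ^ m) atTop (𝓝 0)) : Tendsto x atTop (𝓝 0) := by
  rw [Metric.tendsto_atTop] at h ⊢
  intro ε hε
  obtain ⟨k, hk⟩ := h (ε ^ m) (by positivity)
  refine ⟨k, fun l hl ↦ ?_⟩
  have h1 := hk l hl
  rw [dist_zero_right, norm_pow] at h1
  rw [dist_zero_right]
  exact lt_of_pow_lt_pow_left₀ m hε.le h1

/-- The second components are built by the contracting two-step recursion. The second equation then
yields the first components by `q`-th roots, and elimination shows that the first equation holds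
too. -/
theorem exists_chain_of_ne_zero {a b : CInfty F} (ha0 : a ≠ 0)
    (ha : ‖a‖ ^ (Fintype.card F - 1) < ‖theta F‖ ^ Fintype.card F ^ 2)
    (hb : ‖b‖ ^ (Fintype.card F - 1) < ‖theta F‖ ^ Fintype.card F ^ 2)
    (w : Fin 2 → CInfty F) (hw : recOp !![0, a; b, 0] w = 0) :
    ∃ z : ℕ → Fin 2 → CInfty F, z 0 = w ∧ Tendsto z atTop (𝓝 0) ∧
      ∀ k, recOp !![0, a; b, 0] (z (k + 1)) = z k ^ Fintype.card F ^ 2 := by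
  obtain ⟨K, hK, hcontr⟩ := exists_recursion_contraction ha0 ha hb
  set q := Fintype.card F
  have hq : 1 < q := Fintype.one_lt_card
  let t : CInfty F → CInfty F → CInfty F := fun y y' ↦
    (1 + elimC a) * y ^ q ^ 2 + elimC a * (theta F ^ q ^ 2 + theta F ^ q ^ 3) * y ^ q ^ 4 -
      elimC a * y' ^ q ^ 4
  -- The index is shifted: `u (k + 1)` is the second component of `z k`. The value `u 0 = 0` stands
  -- for a term before the first and encodes `recOp w = 0`.
  obtain ⟨u, hu0, hu1, hu⟩ := exists_seq_of_two_step
    (fun y' y v ↦ v + elimP a b * v ^ q ^ 2 + elimR a * v ^ q ^ 4 = t y y' ∧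
      termSize a b v ≤ ‖t y y'‖) 0 (w 1) (fun y' y ↦ by
      obtain ⟨v, hv, h1, h2, h3⟩ := exists_trinomial_eq (elimP a b) (elimR a) (t y y')
        (Nat.one_lt_pow two_ne_zero hq) (Nat.pow_lt_pow_right hq (by norm_num : 2 < 4))
      exact ⟨v, hv, max_le h1 (max_le h2 h3)⟩)
  have hulim : Tendsto u atTop (𝓝 0) := by
    have hlim : Tendsto (fun k ↦ termSize a b (u k)) atTop (𝓝 0) :=
      tendsto_zero_of_two_step_le (fun k ↦ le_max_of_le_left (norm_nonneg _)) hK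
        (fun k ↦ (hu k).2.trans (hcontr _ _))
    exact tendsto_zero_iff_norm_tendsto_zero.2
      (squeeze_zero (fun _ ↦ norm_nonneg _) (fun k ↦ le_max_left _ _) hlim)
  have hex : ∀ k, ∃ x : CInfty F,
      x ^ q = (u k ^ q ^ 2 - u (k + 1) - theta F ^ q * u (k + 1) ^ q ^ 2) / a :=
    fun k ↦ IsAlgClosed.exists_pow_nat_eq _ (zero_lt_one.trans hq)
  choose x hx using hex
  have hsnd : ∀ k, u (k + 1) + theta F ^ q * u (k + 1) ^ q ^ 2 + a * x k ^ q = u k ^ q ^ 2 := by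
    intro k
    rw [hx]; field_simp; ring
  have hu1lim : Tendsto (fun k ↦ u (k + 1)) atTop (𝓝 0) := hulim.comp (tendsto_add_atTop_nat 1)
  have hxlim : Tendsto x atTop (𝓝 0) := by
    refine tendsto_zero_of_pow (m := q) ?_
    simp only [hx]
    have hq2 : q ^ 2 ≠ 0 := by positivity
    have := (((hulim.pow (q ^ 2)).sub hu1lim).sub
      ((hu1lim.pow (q ^ 2)).const_mul (theta F ^ q))).div_const a
    simpa [zero_pow hq2] using this
  refine ⟨fun k ↦ ![x k, u (k + 1)], ?_, ?_, fun k ↦ ?_⟩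
  · have h2 := ((recOp_offDiag_eq_iff a b w 0).1 hw).2
    have h3 := hsnd 0
    rw [zero_add, hu1, hu0, zero_pow (by positivity)] at h3
    -- The root chosen for `x 0` is the prescribed `w 0`, because `q`-th roots are unique.
    have h4 : a * x 0 ^ q = a * w 0 ^ q := by
      rw [Pi.zero_apply] at h2
      linear_combination h3 - h2
    funext i
    fin_cases i
    · exact pow_card_injective (mul_left_cancel₀ ha0 h4)
    · exact hu1
  · refine tendsto_pi_nhds.2 fun i ↦ ?_
    fin_cases i
    · exact hxlim
    · exact hu1lim
  · refine (recOp_offDiag_eq_iff _ _ _ _).2 ⟨?_, hsnd (k + 1)⟩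
    refine (elimination ha0 (hsnd (k + 1))).2 ?_
    have h1 := mul_pow_eq_elimC_mul ha0 (hsnd k)
    have h2 := (hu k).1
    have e : (u (k + 1) ^ q ^ 2) ^ q ^ 2 = u (k + 1) ^ q ^ 4 := by
      rw [← pow_mul]; congr 1; ring
    have e' : (u k ^ q ^ 2) ^ q ^ 2 = u k ^ q ^ 4 := by
      rw [← pow_mul]; congr 1; ring
    have e'' : (x k ^ q ^ 2) ^ q = (x k ^ q) ^ q ^ 2 := by
      rw [← pow_mul, ← pow_mul, mul_comm]
    change u (k + 2) + elimP a b * u (k + 2) ^ q ^ 2 + elimR a * u (k + 2) ^ q ^ 4 =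
      u (k + 1) ^ q ^ 2 - a * (x k ^ q ^ 2) ^ q +
        theta F ^ q ^ 2 * elimC a * (u (k + 1) ^ q ^ 2) ^ q ^ 2
    rw [h2, e, e'', h1, e']
    ring

/-- Below the critical size of the entries, `h¹ = 4`. -/
theorem h1_offDiag_eq_four {a b : CInfty F}
    (ha : ‖a‖ ^ (Fintype.card F - 1) < ‖theta F‖ ^ Fintype.card F ^ 2)
    (hb : ‖b‖ ^ (Fintype.card F - 1) < ‖theta F‖ ^ Fintype.card F ^ 2) :
    h1 F (TMotive !![0, a; b, 0]) = 4 := by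
  obtain ⟨hfd, hrank⟩ := finrank_ker_recOp_offDiag a b
  have h1 := h1_le_finrank_ker !![0, a; b, 0]
  have h2 := finrank_ker_le_h1 !![0, a; b, 0] (fun w hw ↦ by
    by_cases ha0 : a = 0
    · subst ha0
      exact exists_chain_of_eq_zero b w
    · exact exists_chain_of_ne_zero ha0 ha hb w hw)
  rw [hrank] at h1 h2
  exact le_antisymm (by exact_mod_cast h1) (by exact_mod_cast h2)

end Chains

/-! ### Vanishing of `H¹` at the critical size -/

section Critical

open Filter Topology

variable {F : Type*} [Field F] [Fintype F]

/-- If `x` and `η` solve the rescaled equations at the critical size with right hand sides `r`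
and `s` of norm at most `1`, then `‖η‖ ≤ 1` and `‖x‖ ≤ 1`. -/
theorem critical_norm_le_one {x η r s : CInfty F}
    (h2 : η + (theta F)⁻¹ * η ^ Fintype.card F ^ 2 + x ^ Fintype.card F = s)
    (h3 : x - η ^ Fintype.card F ^ 3 = r) (hr : ‖r‖ ≤ 1) (hs : ‖s‖ ≤ 1) :
    ‖η‖ ≤ 1 ∧ ‖x‖ ≤ 1 := by
  have hΘ := one_lt_norm_theta (F := F)
  set q := Fintype.card F
  have hq : 1 < q := Fintype.one_lt_card
  have hx : x = η ^ q ^ 3 + r := by linear_combination h3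
  have hη : ‖η‖ ≤ 1 := by
    -- If `|η| > 1`, then `|x^q| = |η|^(q⁴)`, which the other terms of the first equation, of norm
    -- at most `|η|^(q²)`, cannot balance.
    by_contra! hN
    have hN3 : 1 < ‖η ^ q ^ 3‖ := by
      rw [norm_pow]; exact one_lt_pow₀ hN (by positivity)
    have hxn : ‖x‖ = ‖η‖ ^ q ^ 3 := by
      rw [hx, IsUltrametricDist.norm_add_eq_max_of_norm_ne_norm (hr.trans_lt hN3).ne',
        max_eq_left (hr.trans hN3.le), norm_pow]
    have h4 : x ^ q = s + -(η + (theta F)⁻¹ * η ^ q ^ 2) := by linear_combination h2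
    have h5 : ‖x ^ q‖ ≤ ‖η‖ ^ q ^ 2 := by
      rw [h4]
      refine (IsUltrametricDist.norm_add_le_max _ _).trans (max_le ?_ ?_)
      · exact hs.trans (one_le_pow₀ hN.le)
      · rw [norm_neg]
        refine (IsUltrametricDist.norm_add_le_max _ _).trans (max_le ?_ ?_)
        · exact le_self_pow₀ hN.le (by positivity)
        · rw [norm_mul, norm_inv, norm_pow]
          exact mul_le_of_le_one_left (by positivity) (inv_le_one_of_one_le₀ hΘ.le)
    rw [norm_pow, hxn, ← pow_mul, ← pow_succ] at h5
    exact absurd h5 (not_le.2 (pow_lt_pow_right₀ hN (Nat.pow_lt_pow_right hq (by norm_num))))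
  refine ⟨hη, ?_⟩
  rw [hx]
  refine (IsUltrametricDist.norm_add_le_max _ _).trans (max_le ?_ hr)
  rw [norm_pow]
  exact pow_le_one₀ (norm_nonneg _) hη

/-- Here `x = η^(q³)`. If `|η| < 1`, every other term of the first equation is smaller than `η`
unless `η = 0`. -/
theorem critical_kernel {x η : CInfty F}
    (h2 : η + (theta F)⁻¹ * η ^ Fintype.card F ^ 2 + x ^ Fintype.card F = 0)
    (h3 : x - η ^ Fintype.card F ^ 3 = 0) : (x = 0 ∧ η = 0) ∨ (‖x‖ = 1 ∧ ‖η‖ = 1) := by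
  have hΘ := one_lt_norm_theta (F := F)
  obtain ⟨hη, -⟩ := critical_norm_le_one h2 h3 (by simp) (by simp)
  set q := Fintype.card F
  have hq : 1 < q := Fintype.one_lt_card
  have hx : x = η ^ q ^ 3 := by linear_combination h3
  rcases hη.eq_or_lt with h1 | h1
  · right
    refine ⟨?_, h1⟩
    rw [hx, norm_pow, h1, one_pow]
  · left
    suffices h0 : η = 0 by
      refine ⟨?_, h0⟩
      rw [hx, h0, zero_pow (by positivity)]
    by_contra h0
    have hpos : 0 < ‖η‖ := norm_pos_iff.2 h0
    have hlt : ∀ m, 1 < m → ‖η‖ ^ m < ‖η‖ := fun m hm ↦ pow_lt_self_of_lt_one₀ hpos h1 hm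
    have h4 : η = -((theta F)⁻¹ * η ^ q ^ 2 + x ^ q) := by linear_combination h2
    have h5 : ‖(theta F)⁻¹ * η ^ q ^ 2 + x ^ q‖ < ‖η‖ := by
      refine (IsUltrametricDist.norm_add_le_max _ _).trans_lt (max_lt ?_ ?_)
      · rw [norm_mul, norm_inv, norm_pow]
        exact (mul_le_of_le_one_left (by positivity) (inv_le_one_of_one_le₀ hΘ.le)).trans_lt
          (hlt _ (Nat.one_lt_pow two_ne_zero hq))
      · rw [hx, ← pow_mul, ← pow_succ, norm_pow]
        exact hlt _ (Nat.one_lt_pow (by norm_num) hq)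
    refine absurd h5 (not_lt.2 (le_of_eq ?_))
    conv_lhs => rw [h4, norm_neg]

/-- Modulo elements of norm less than 1 the equations read `η = -x^q` and `x = η^(q³) + r`. If
either `x` or `η` reduced to zero, so would the other, and then `r`. -/
theorem critical_step {x η r s : CInfty F}
    (h2 : η + (theta F)⁻¹ * η ^ Fintype.card F ^ 2 + x ^ Fintype.card F = s)
    (h3 : x - η ^ Fintype.card F ^ 3 = r) (hr : ‖r‖ = 1) (hs : ‖s‖ < 1) :
    ‖x‖ = 1 ∧ ‖η‖ = 1 := by
  have hΘ := one_lt_norm_theta (F := F)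
  obtain ⟨hη, hx1⟩ := critical_norm_le_one h2 h3 hr.le hs.le
  set q := Fintype.card F
  have hq : 1 < q := Fintype.one_lt_card
  have hx : x = η ^ q ^ 3 + r := by linear_combination h3
  have hsmall : ‖(theta F)⁻¹ * η ^ q ^ 2‖ < 1 := by
    rw [norm_mul, norm_inv, norm_pow]
    exact (mul_le_of_le_one_right (by positivity) (pow_le_one₀ (norm_nonneg _) hη)).trans_lt
      (inv_lt_one_of_one_lt₀ hΘ)
  have hη1 : ‖η‖ = 1 := by
    refine hη.eq_or_lt.resolve_right fun hlt ↦ ?_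
    have hη3 : ‖η ^ q ^ 3‖ < 1 := by
      rw [norm_pow]; exact pow_lt_one₀ (norm_nonneg _) hlt (by positivity)
    have hxn : ‖x‖ = 1 := by
      rw [hx, IsUltrametricDist.norm_add_eq_max_of_norm_ne_norm (by rw [hr]; exact hη3.ne), hr,
        max_eq_right hη3.le]
    have h4 : x ^ q = s + -(η + (theta F)⁻¹ * η ^ q ^ 2) := by linear_combination h2
    have h5 : ‖x ^ q‖ < 1 := by
      rw [h4]
      refine (IsUltrametricDist.norm_add_le_max _ _).trans_lt (max_lt hs ?_)
      rw [norm_neg]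
      exact (IsUltrametricDist.norm_add_le_max _ _).trans_lt (max_lt hlt hsmall)
    rw [norm_pow, hxn, one_pow] at h5
    exact lt_irrefl _ h5
  refine ⟨hx1.eq_or_lt.resolve_right fun hlt ↦ ?_, hη1⟩
  have h4 : η = s + -((theta F)⁻¹ * η ^ q ^ 2 + x ^ q) := by linear_combination h2
  have h5 : ‖s + -((theta F)⁻¹ * η ^ q ^ 2 + x ^ q)‖ < 1 := by
    refine (IsUltrametricDist.norm_add_le_max _ _).trans_lt (max_lt hs ?_)
    rw [norm_neg]
    refine (IsUltrametricDist.norm_add_le_max _ _).trans_lt (max_lt hsmall ?_)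
    rw [norm_pow]
    exact pow_lt_one₀ (norm_nonneg _) hlt (by positivity)
  rw [← h4, hη1] at h5
  exact lt_irrefl _ h5

/-- The equations for `x` and `y = a η` at the critical size, after rescaling. -/
theorem critical_rescale {a : CInfty F} (ha0 : a ≠ 0)
    (ha : a ^ (Fintype.card F - 1) = (theta F)⁻¹) {x y r s : CInfty F}
    (h1 : x + theta F ^ Fintype.card F * x ^ Fintype.card F ^ 2 +
      theta F ^ Fintype.card F / a ^ Fintype.card F * y ^ Fintype.card F = r)
    (h2 : y + theta F ^ Fintype.card F * y ^ Fintype.card F ^ 2 + a * x ^ Fintype.card F = s) :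
    y / a + (theta F)⁻¹ * (y / a) ^ Fintype.card F ^ 2 + x ^ Fintype.card F = s / a ∧
    x - (y / a) ^ Fintype.card F ^ 3 =
      r - theta F ^ Fintype.card F * (s / a) ^ Fintype.card F := by
  have hθ : theta F ≠ 0 := norm_pos_iff.1 (zero_lt_one.trans one_lt_norm_theta)
  set q := Fintype.card F with hqdef
  have hq : 1 < q := Fintype.one_lt_card
  obtain ⟨η, rfl⟩ : ∃ η, y = a * η := ⟨y / a, by field_simp⟩
  obtain ⟨σ, rfl⟩ : ∃ σ, s = a * σ := ⟨s / a, by field_simp⟩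
  rw [mul_div_cancel_left₀ _ ha0, mul_div_cancel_left₀ _ ha0]
  -- Since `q² - 1 = (q - 1)(q + 1)`, the choice of `a` gives `a^(q² - 1) = θ^(-(q + 1))`.
  have haq : theta F ^ q * a ^ q ^ 2 = a * (theta F)⁻¹ := by
    have e : q ^ 2 = (q - 1) * (q + 1) + 1 := by
      obtain ⟨d, hd⟩ := Nat.exists_eq_add_of_le' hq.le
      rw [hd, Nat.add_sub_cancel]; ring
    rw [e, pow_succ, pow_mul, ha, inv_pow, pow_succ]
    field_simp
  have h2' : η + (theta F)⁻¹ * η ^ q ^ 2 + x ^ q = σ := by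
    refine mul_left_cancel₀ ha0 ?_
    rw [mul_pow] at h2
    linear_combination h2 - η ^ q ^ 2 * haq
  refine ⟨h2', ?_⟩
  -- The `q`-th power of the rescaled second equation contains `x^(q²) + η^q`, the combination that
  -- `θ^q` multiplies in the first. Subtracting removes both.
  have h4 := congrArg (fun u ↦ u ^ q) h2'
  simp only [add_pow_card, mul_pow, hqdef] at h4
  rw [← hqdef, ← pow_mul η, ← pow_succ, ← pow_mul x, ← pow_two, inv_pow] at h4
  have h1' : x + theta F ^ q * (x ^ q ^ 2 + η ^ q) = r := by
    rw [← h1, mul_pow]; field_simp; ring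
  have h5 : theta F ^ q * (theta F ^ q)⁻¹ = 1 := mul_inv_cancel₀ (pow_ne_zero _ hθ)
  linear_combination h1' - theta F ^ q * h4 + η ^ q ^ (2 + 1) * h5

/-- The first non-zero coefficient would be a non-zero kernel element, with rescaled components of
norm 1. All later coefficients would keep this norm, contrary to convergence to zero. -/
theorem h1_critical_eq_zero {a : CInfty F} (ha0 : a ≠ 0)
    (ha : a ^ (Fintype.card F - 1) = (theta F)⁻¹) :
    h1 F (TMotive !![0, a; theta F ^ Fintype.card F / a ^ Fintype.card F, 0]) = 0 := by
  have hΘ := one_lt_norm_theta (F := F)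
  have hθ : theta F ≠ 0 := norm_pos_iff.1 (zero_lt_one.trans hΘ)
  set b := theta F ^ Fintype.card F / a ^ Fintype.card F with hb
  set q := Fintype.card F with hqdef
  have hq : 1 < q := Fintype.one_lt_card
  have haq : ‖a ^ q ^ 2 / a‖ * ‖theta F‖ ^ (q + 1) = 1 := by
    have e : q ^ 2 = (q - 1) * (q + 1) + 1 := by
      obtain ⟨d, hd⟩ := Nat.exists_eq_add_of_le' hq.le
      rw [hd, Nat.add_sub_cancel]; ring
    rw [e, pow_succ, pow_mul, ha, mul_div_assoc, div_self ha0, mul_one, norm_pow, norm_inv,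
      ← mul_pow, inv_mul_cancel₀ (zero_lt_one.trans hΘ).ne', one_pow]
  suffices hsub : ∀ v : H1 F (TMotive !![0, a; b, 0]), v = 0 by
    have : Subsingleton (H1 F (TMotive !![0, a; b, 0])) := ⟨fun v w ↦ by rw [hsub v, hsub w]⟩
    exact rank_subsingleton' _ _
  intro v
  refine eq_zero_of_h1Coeff _ v ?_
  set z : ℕ → Fin 2 → CInfty F := fun k ↦ h1Coeff !![0, a; b, 0] k v with hz
  have hlim := tendsto_h1Coeff !![0, a; b, 0] v
  -- The rescaled right side `s` has norm `|θ|^(-(q + 1))`, so both `s` and the correction `θ^q s^q`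
  -- have norm less than 1, and `critical_step` applies.
  have hstep : ∀ k, ‖z k 0‖ = 1 ∧ ‖z k 1 / a‖ = 1 → ‖z (k + 1) 0‖ = 1 ∧ ‖z (k + 1) 1 / a‖ = 1 := by
    rintro k ⟨hx, hy⟩
    obtain ⟨e1, e2⟩ := (recOp_offDiag_eq_iff a b (z (k + 1)) _).1
      (recOp_h1Coeff_succ !![0, a; b, 0] v k)
    obtain ⟨f2, f3⟩ := critical_rescale ha0 ha e1 e2
    have hs : ‖(h1Coeff !![0, a; b, 0] k v ^ Fintype.card F ^ 2) 1 / a‖ * ‖theta F‖ ^ (q + 1)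
        = 1 := by
      have e : (h1Coeff !![0, a; b, 0] k v ^ Fintype.card F ^ 2) 1 / a =
          (a ^ q ^ 2 / a) * (z k 1 / a) ^ q ^ 2 := by
        rw [Pi.pow_apply, div_pow]
        field_simp
        rfl
      rw [e, norm_mul, norm_pow, hy, one_pow, mul_one, haq]
    set s := (h1Coeff !![0, a; b, 0] k v ^ Fintype.card F ^ 2) 1 / a
    have hs1 : ‖s‖ < 1 := by
      by_contra! hge
      have : 1 < ‖s‖ * ‖theta F‖ ^ (q + 1) :=
        one_lt_mul_of_le_of_lt hge (one_lt_pow₀ hΘ (Nat.succ_ne_zero q))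
      exact absurd hs this.ne'
    have hθs : ‖theta F ^ q * s ^ q‖ < 1 := by
      rw [← mul_pow, norm_pow]
      refine pow_lt_one₀ (norm_nonneg _) ?_ (by positivity)
      rw [norm_mul, ← hs, mul_comm]
      have : ‖theta F‖ < ‖theta F‖ ^ (q + 1) := lt_self_pow₀ hΘ (by lia)
      have hspos : 0 < ‖s‖ := by
        refine (norm_nonneg s).lt_of_ne fun h0 ↦ ?_
        rw [← h0, zero_mul] at hs
        exact zero_ne_one hs
      gcongr
    refine critical_step f2 f3 ?_ hs1
    have hr : ‖(h1Coeff !![0, a; b, 0] k v ^ Fintype.card F ^ 2) 0‖ = 1 := by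
      rw [Pi.pow_apply, norm_pow]
      change ‖z k 0‖ ^ _ = 1
      rw [hx, one_pow]
    rw [sub_eq_add_neg, IsUltrametricDist.norm_add_eq_max_of_norm_ne_norm (by
      rw [hr, norm_neg]; exact hθs.ne'), hr, norm_neg, max_eq_left hθs.le]
  have hker : ∀ k, recOp !![0, a; b, 0] (z k) = 0 →
      z k = 0 ∨ (‖z k 0‖ = 1 ∧ ‖z k 1 / a‖ = 1) := by
    intro k hk
    obtain ⟨e1, e2⟩ := (recOp_offDiag_eq_iff a b (z k) 0).1 hk
    obtain ⟨f2, f3⟩ := critical_rescale ha0 ha e1 e2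
    have hp : Fintype.card F ≠ 0 := Fintype.card_ne_zero
    refine (critical_kernel (by simpa using f2) (by simpa [zero_pow hp] using f3)).imp_left ?_
    rintro ⟨h0, h1⟩
    have h1' : z k 1 = 0 := (div_eq_zero_iff.1 h1).resolve_right ha0
    funext i
    fin_cases i
    · exact h0
    · exact h1'
  have hnot : ∀ k, ¬ (‖z k 0‖ = 1 ∧ ‖z k 1 / a‖ = 1) := by
    intro k hk
    have hall : ∀ l, ‖z (k + l) 0‖ = 1 ∧ ‖z (k + l) 1 / a‖ = 1 := by
      intro l
      induction l with
      | zero => exact hk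
      | succ l ih => exact hstep _ ih
    have h0 := tendsto_zero_iff_norm_tendsto_zero.1 (tendsto_pi_nhds.1 hlim 0)
    obtain ⟨m, hm⟩ := eventually_atTop.1 (h0.eventually_lt_const one_pos)
    have h1 := hm (k + m) (Nat.le_add_left _ _)
    exact absurd (hall m).1 h1.ne
  intro k
  change z k = 0
  induction k with
  | zero => exact (hker 0 (recOp_h1Coeff_zero _ v)).resolve_right (hnot 0)
  | succ k ih =>
    refine (hker (k + 1) ?_).resolve_right (hnot (k + 1))
    refine (recOp_h1Coeff_succ _ v k).trans ?_
    change z k ^ _ = 0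
    rw [ih, zero_pow]
    exact pow_ne_zero _ Fintype.card_ne_zero

end Critical

/-! ### From norms to `ord`, and the critical example -/

section Ord

variable {F : Type*} [Field F] [Fintype F]

theorem norm_pow_lt_of_lt_ord {x : CInfty F}
    (h : ((-((Fintype.card F : ℝ) ^ 2 / ((Fintype.card F : ℝ) - 1)) : ℝ) : EReal) < ord x) :
    ‖x‖ ^ (Fintype.card F - 1) < ‖theta F‖ ^ Fintype.card F ^ 2 := by
  have hq : (1 : ℝ) < Fintype.card F := by exact_mod_cast Fintype.one_lt_card (α := F)
  have hq' : 1 < Fintype.card F := Fintype.one_lt_card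
  rw [norm_theta]
  by_cases hx : x = 0
  · rw [hx, norm_zero, zero_pow (by lia)]
    positivity
  · rw [ord, if_neg hx, EReal.coe_lt_coe_iff, neg_lt_neg_iff, lt_div_iff₀ (by linarith)] at h
    have hxp : 0 < ‖x‖ := norm_pos_iff.2 hx
    rw [← Real.logb_lt_logb_iff hq (by positivity) (by positivity), Real.logb_pow, Real.logb_pow,
      Real.logb_self_eq_one hq, mul_one, Nat.cast_sub hq'.le]
    push_cast
    linarith

theorem ord_eq_of_norm_pow {x : CInfty F} (hx : x ≠ 0) {c : ℝ}
    (h : ((Fintype.card F : ℝ) - 1) * Real.logb (Fintype.card F) ‖x‖ = -c) :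
    ord x = ((c / ((Fintype.card F : ℝ) - 1) : ℝ) : EReal) := by
  have hq : (1 : ℝ) < Fintype.card F := by exact_mod_cast Fintype.one_lt_card (α := F)
  have hq1 : (Fintype.card F : ℝ) - 1 ≠ 0 := by linarith
  rw [ord, if_neg hx]
  congr 1
  field_simp
  linarith

/-- Take `a` to be a `(q - 1)`-th root of `θ⁻¹` and `b = θ^q / a^q`, so that `ord b = -q - q / (q -
1) = -q² / (q - 1)`. -/
theorem exists_critical (F : Type*) [Field F] [Fintype F] : ∃ a b : CInfty F,
    ord a = ((1 / ((Fintype.card F : ℝ) - 1) : ℝ) : EReal) ∧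
    ord b = ((-((Fintype.card F : ℝ) ^ 2 / ((Fintype.card F : ℝ) - 1)) : ℝ) : EReal) ∧
    h1 F (TMotive !![0, a; b, 0]) = 0 := by
  have hq : (1 : ℝ) < Fintype.card F := by exact_mod_cast Fintype.one_lt_card (α := F)
  have hq' : 1 < Fintype.card F := Fintype.one_lt_card
  have hθ : theta F ≠ 0 := norm_pos_iff.1 (zero_lt_one.trans one_lt_norm_theta)
  obtain ⟨a, ha⟩ := IsAlgClosed.exists_pow_nat_eq (theta F)⁻¹
    (n := Fintype.card F - 1) (by lia)
  have ha0 : a ≠ 0 := by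
    rintro rfl
    rw [zero_pow (by lia)] at ha
    exact inv_ne_zero hθ ha.symm
  have hlog : ((Fintype.card F : ℝ) - 1) * Real.logb (Fintype.card F) ‖a‖ = -1 := by
    have h := congrArg (fun u ↦ Real.logb (Fintype.card F) ‖u‖) ha
    simp only [norm_pow, norm_inv, Real.logb_pow, Real.logb_inv, norm_theta,
      Real.logb_self_eq_one hq, Nat.cast_sub hq'.le, Nat.cast_one] at h
    exact h
  have hb0 : theta F ^ Fintype.card F / a ^ Fintype.card F ≠ 0 :=
    div_ne_zero (pow_ne_zero _ hθ) (pow_ne_zero _ ha0)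
  refine ⟨a, theta F ^ Fintype.card F / a ^ Fintype.card F, ord_eq_of_norm_pow ha0 hlog, ?_,
    h1_critical_eq_zero ha0 ha⟩
  rw [← neg_div]
  refine ord_eq_of_norm_pow hb0 ?_
  rw [norm_div, norm_pow, norm_pow, norm_theta, Real.logb_div (by positivity)
    (pow_ne_zero _ (norm_ne_zero_iff.2 ha0)), Real.logb_pow, Real.logb_pow,
    Real.logb_self_eq_one hq]
  linear_combination (-(Fintype.card F : ℝ)) * hlog

theorem isUniformizable_iff (a b : CInfty F) :
    IsUniformizable F (TMotive !![0, a; b, 0]) ↔ h1 F (TMotive !![0, a; b, 0]) = 4 := by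
  rw [IsUniformizable, rank_TMotive]
  norm_num

end Ord

end

end AndersonMotive

open AndersonMotive
theorem proposition6p2 (F : Type*) [Field F] [Fintype F] (q : ℕ) (hq : Fintype.card F = q) :
    (∀ a₁₂ a₂₁ : CInfty F,
      ((-((q : ℝ) ^ 2 / ((q : ℝ) - 1)) : ℝ) : EReal) < ord a₁₂ →
      ((-((q : ℝ) ^ 2 / ((q : ℝ) - 1)) : ℝ) : EReal) < ord a₂₁ →
      IsUniformizable F (TMotive !![0, a₁₂; a₂₁, 0]) ∧
        h1 F (TMotive !![0, a₁₂; a₂₁, 0]) = 4) ∧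
    (∃ a₁₂ a₂₁ : CInfty F,
      ord a₁₂ = ((1 / ((q : ℝ) - 1) : ℝ) : EReal) ∧
      ord a₂₁ = ((-((q : ℝ) ^ 2 / ((q : ℝ) - 1)) : ℝ) : EReal) ∧
      h1 F (TMotive !![0, a₁₂; a₂₁, 0]) = 0 ∧
      ¬ IsUniformizable F (TMotive !![0, a₁₂; a₂₁, 0])) ∧
    IsLeast {c : EReal | ∀ a₁₂ a₂₁ : CInfty F, c < ord a₁₂ → c < ord a₂₁ →
        IsUniformizable F (TMotive !![0, a₁₂; a₂₁, 0])}
      ((-((q : ℝ) ^ 2 / ((q : ℝ) - 1)) : ℝ) : EReal) := by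
  subst hq
  have hcard : (1 : ℝ) < Fintype.card F := by exact_mod_cast Fintype.one_lt_card (α := F)
  have hupper : ∀ a₁₂ a₂₁ : CInfty F,
      ((-((Fintype.card F : ℝ) ^ 2 / ((Fintype.card F : ℝ) - 1)) : ℝ) : EReal) < ord a₁₂ →
      ((-((Fintype.card F : ℝ) ^ 2 / ((Fintype.card F : ℝ) - 1)) : ℝ) : EReal) < ord a₂₁ →
      h1 F (TMotive !![0, a₁₂; a₂₁, 0]) = 4 := fun a₁₂ a₂₁ h₁ h₂ ↦
    h1_offDiag_eq_four (norm_pow_lt_of_lt_ord h₁) (norm_pow_lt_of_lt_ord h₂)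
  obtain ⟨a, b, ha, hb, h0⟩ := exists_critical F
  have hnot : ¬ IsUniformizable F (TMotive !![0, a; b, 0]) := by
    rw [isUniformizable_iff, h0]
    exact OfNat.zero_ne_ofNat 4
  refine ⟨fun a₁₂ a₂₁ h₁ h₂ ↦ ⟨(isUniformizable_iff _ _).2 (hupper _ _ h₁ h₂), hupper _ _ h₁ h₂⟩,
    ⟨a, b, ha, hb, h0, hnot⟩, fun a₁₂ a₂₁ h₁ h₂ ↦ (isUniformizable_iff _ _).2 (hupper _ _ h₁ h₂),
    fun c hc ↦ ?_⟩
  by_contra! hlt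
  refine hnot (hc a b (hlt.trans_le ?_) (hlt.trans_le hb.ge))
  rw [ha, EReal.coe_le_coe_iff]
  have h1 : 0 ≤ (Fintype.card F : ℝ) ^ 2 / ((Fintype.card F : ℝ) - 1) :=
    div_nonneg (by positivity) (by linarith)
  have h2 : 0 ≤ 1 / ((Fintype.card F : ℝ) - 1) := div_nonneg one_pos.le (by linarith)
  linarith
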